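/- For every sample size $n\ge 1$ let $(X_1,Y_1),\dots,(X_n,Y_n)$ be independent (not necessarily identically distributed) with $X_i\in\mathcal X$, $Y_i\in\mathbb R$, and let $\psi_1,\dots,\psi_p$ be measurable functions on $\mathcal X$, where $p\ge 2$; the distributions, $\mathcal X$, the $\psi_j$, $p$ and the constants $K_0,K_X$ below may all depend on $n$. For $f:\mathcal X\to\mathbb R$ put $\|f\|_n^2=\frac1n\sum_{i=1}^n f(X_i)^2$, $\|f\|^2=\frac1n\sum_{i=1}^n\mathbb E f(X_i)^2$, $\|\mathbf Y-f\|_n^2=\frac1n\sum_{i=1}^n (Y_i-f(X_i))^2$ and $\|\mathbf Y-f\|^2=\frac1n\sum_{i=1}^n\mathbb E(Y_i-f(X_i))^2$. For $S\subset\{1,\dots,p\}$ let $\mathcal F_S=\{\sum_{j\in S}\beta_j\psi_j:\beta\in\mathbb R^p\}$, let $\hat f_S\in\arg\min_{f\in\mathcal F_S}\|\mathbf Y-f\|_n$ be a least squares estimator, and let $f_S^*\in\mathcal F_S$ be the projection on $\mathcal F_S$ of the regression $f^0(X_i)=\mathbb E(Y_i\mid X_i)$, i.e. the minimizer of $\frac1n\sum_{i=1}^n\mathbb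 E(f^0(X_i)-f(X_i))^2$ over $f\in\mathcal F_S$. Suppose that $\max_{i}\|Y_i\|_{\Psi_2}\le K_0<\infty$, where $\|Z\|_{\Psi_2}=\inf\{L>0:\mathbb E\exp(|Z/L|^2)-1<1\}$, that $\max_{i,j}|\psi_j(X_i)|\le K_X$ almost surely, that the smallest eigenvalue $\Lambda_{\min}^2$ of the matrix $\Sigma=\big(\frac1n\sum_{i=1}^n\mathbb E\,\psi_j(X_i)\psi_k(X_i)\big)_{j,k}$ is positive, and that $\delta_n\to0$ as $n\to\infty$, where $$\delta_n^2:=\frac{K_X^2(1+K_0^2)\,p\log p}{n\Lambda_{\min}^2}.$$ Then $$\max_{S\subset\{1,\dots,p\}}\|\hat f_S-f_S^*\|=\mathcal O_{\mathbb P}(\delta_n).$$ Moreover, if $K_0$ stays bounded as $n$ varies (in particular if $K_0$ is a fixed constant), then $$\max_{S\subset\{1,\dots,p\}}\Big|\|\mathbf Y-\hat f_S\|_n^2-\|\mathbf Y-f_S^*\|^2\Big|=\mathcal O_{\mathbb P}(\delta_n).$$ Here $Z_n=\mathcal O_{\mathbb P}(\delta_n)$ means: for every $\varepsilon>0$ there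 is an $M$ such that $\mathbb P(|Z_n|>M\delta_n)\le\varepsilon$ for all sufficiently large $n$. -/

import Mathlib

open MeasureTheory ProbabilityTheory Filter
open scoped NNReal ENNReal Topology

noncomputable section

namespace LSWrongModel

/-- The Orlicz norm `‖Z‖_{Ψ₂} = inf {L > 0 : E exp(|Z/L|²) - 1 < 1}`, with value `∞` if there is
no such `L`. -/
def psiTwoNorm {Ω : Type*} [MeasurableSpace Ω] (μ : Measure Ω) (Z : Ω → ℝ) : ℝ≥0∞ :=
  sInf {a : ℝ≥0∞ | ∃ L : ℝ, 0 < L ∧ a = ENNReal.ofReal L ∧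
    ∫⁻ ω, ENNReal.ofReal (Real.exp (|Z ω / L| ^ 2) - 1) ∂μ < 1}

/-- `Y₁, …, Yₙ` is uniformly sub-Gaussian with constant `K₀`. -/
def UniformlySubGaussian {Ω : Type*} [MeasurableSpace Ω] {n : ℕ} (μ : Measure Ω)
    (Y : Fin n → Ω → ℝ) (K₀ : ℝ≥0) : Prop :=
  ∀ i, psiTwoNorm μ (Y i) ≤ (K₀ : ℝ≥0∞)

/-- The empirical norm `‖Z‖_n = (∑ i, Zᵢ² / n)^{1/2}`, at the outcome `ω`. A function `f` on the
covariate space enters as `Zᵢ = f(Xᵢ)`. -/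
def empNorm {Ω : Type*} {n : ℕ} (Z : Fin n → Ω → ℝ) (ω : Ω) : ℝ :=
  Real.sqrt ((∑ i, (Z i ω) ^ 2) / n)

/-- The theoretical norm `‖Z‖ = (∑ i, E Zᵢ² / n)^{1/2}`. -/
def theoNorm {Ω : Type*} [MeasurableSpace Ω] {n : ℕ} (μ : Measure Ω) (Z : Fin n → Ω → ℝ) : ℝ :=
  Real.sqrt ((∑ i, ∫ ω, (Z i ω) ^ 2 ∂μ) / n)

/-- `f_β = ∑ j, β_j ψ_j`. -/
def linFun {𝒳 : Type*} {p : ℕ} (ψ : Fin p → 𝒳 → ℝ) (β : Fin p → ℝ) : 𝒳 → ℝ :=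
  fun x => ∑ j, β j * ψ j x

/-- `β_S`: the vector with `β_{j,S} = β_j` if `j ∈ S` and `0` otherwise. -/
def restrictTo {p : ℕ} (S : Finset (Fin p)) (β : Fin p → ℝ) : Fin p → ℝ :=
  fun j => if j ∈ S then β j else 0

/-- `𝓕_S = {f_{β_S} : β ∈ ℝ^p}`. -/
def modelClass {𝒳 : Type*} {p : ℕ} (ψ : Fin p → 𝒳 → ℝ) (S : Finset (Fin p)) : Set (𝒳 → ℝ) :=
  {f | ∃ β : Fin p → ℝ, f = linFun ψ (restrictTo S β)}

/-- `f` is a least squares estimator over the class `𝓕`, computed from the data at `ω`. -/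
def IsLeastSquares {Ω 𝒳 : Type*} {n : ℕ} (X : Fin n → Ω → 𝒳) (Y : Fin n → Ω → ℝ)
    (𝓕 : Set (𝒳 → ℝ)) (ω : Ω) (f : 𝒳 → ℝ) : Prop :=
  f ∈ 𝓕 ∧ ∀ g ∈ 𝓕, empNorm (fun i ω' => Y i ω' - f (X i ω')) ω
    ≤ empNorm (fun i ω' => Y i ω' - g (X i ω')) ω

/-- The regression `f⁰(Xᵢ) = E(Yᵢ | Xᵢ)`, as a random variable. -/
def regression {Ω 𝒳 : Type*} [MeasurableSpace Ω] [MeasurableSpace 𝒳] {n : ℕ} (μ : Measure Ω)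
    (X : Fin n → Ω → 𝒳) (Y : Fin n → Ω → ℝ) (i : Fin n) : Ω → ℝ :=
  μ[Y i | MeasurableSpace.comap (X i) inferInstance]

/-- `f` is the projection of `f⁰` on the class `𝓕` for the theoretical norm. -/
def IsProjection {Ω 𝒳 : Type*} [MeasurableSpace Ω] [MeasurableSpace 𝒳] {n : ℕ} (μ : Measure Ω)
    (X : Fin n → Ω → 𝒳) (Y : Fin n → Ω → ℝ) (𝓕 : Set (𝒳 → ℝ)) (f : 𝒳 → ℝ) : Prop :=
  f ∈ 𝓕 ∧ ∀ g ∈ 𝓕, theoNorm μ (fun i ω => regression μ X Y i ω - f (X i ω))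
    ≤ theoNorm μ (fun i ω => regression μ X Y i ω - g (X i ω))

/-- The matrix `Σ = P ψᵀψ`, with entries `∑ i, E ψ_j(Xᵢ) ψ_k(Xᵢ) / n`. -/
def gramMatrix {Ω 𝒳 : Type*} [MeasurableSpace Ω] {n p : ℕ} (μ : Measure Ω)
    (X : Fin n → Ω → 𝒳) (ψ : Fin p → 𝒳 → ℝ) : Matrix (Fin p) (Fin p) ℝ :=
  Matrix.of fun j k => (∑ i, ∫ ω, ψ j (X i ω) * ψ k (X i ω) ∂μ) / n

/-- `Λ_min`, the square root of the smallest eigenvalue of `Σ`. -/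
def lambdaMin {Ω 𝒳 : Type*} [MeasurableSpace Ω] {n p : ℕ} (μ : Measure Ω)
    (X : Fin n → Ω → 𝒳) (ψ : Fin p → 𝒳 → ℝ) : ℝ :=
  Real.sqrt (sInf (spectrum ℝ (gramMatrix μ X ψ)))

/-- The rate `(K_X² (1 + K₀²) p log p / (n Λ²))^{1/2}`. -/
def rate (n p : ℕ) (KX K₀ Λ : ℝ) : ℝ :=
  Real.sqrt (KX ^ 2 * (1 + K₀ ^ 2) * p * Real.log p / (n * Λ ^ 2))

/-- `Z_n = O_P(r_n)`. Each `Z_n` lives on its own probability space; for non-measurable `Z_n` the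
probability is an outer probability. -/
def IsBigOInProb {Ω : ℕ → Type*} [∀ n, MeasurableSpace (Ω n)] (μ : ∀ n, Measure (Ω n))
    (Z : ∀ n, Ω n → ℝ) (r : ℕ → ℝ) : Prop :=
  ∀ ε : ℝ, 0 < ε → ∃ M : ℝ, ∀ᶠ n in atTop,
    μ n {ω | M * r n < |Z n ω|} ≤ ENNReal.ofReal ε

end LSWrongModel

end

/-! Write `f_β` in an orthonormal dictionary `φ` for the theoretical inner product
(`exists_whitening`). Then `‖f‖` is the Euclidean norm of the coordinates, and with `vᵢ = φ(Xᵢ)` one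
has `|vᵢ|² ≤ R = p K_X² / Λ_min²` almost surely and `∑ i, E vᵢvᵢᵀ = n I`. Least squares in every
submodel is governed by three fluctuations that do not depend on `S`: the operator norm of `Ĝ = ∑ i,
vᵢvᵢᵀ - n I`, the length of `ξ = ∑ i, (Yᵢvᵢ - E Yᵢvᵢ)`, and `∑ i, (Yᵢ² - E Yᵢ²)`. No union bound
over the `2^p` submodels is needed.

Let `a`, `b` be the coordinates of the estimator and of the projection in one submodel, and `g = a -
b`. Subtracting the two normal equations gives `∑ i, (g ⬝ vᵢ)² = g ⬝ ξ - g ⬝ Ĝb`. The left side is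
at least `n|g|²/2` once `Ĝ` has norm at most `n/2`, whence a bound on `|g|`; expanding the residual
sum of squares gives the second claim (`leastSquares_comparison`). The regression enters only
through `E Yᵢ g(Xᵢ)`, so the models may be wrong.

The fluctuations of `ξ` and of `∑ Yᵢ²` follow from variances, as sub-Gaussian responses have bounded
second and fourth moments. The matrix `Ĝ` needs a logarithmic dependence on dimension, obtained from
an exchange argument for trace moments (`integral_trace_exchange`). Replacing one `vᵢ` by an
independent copy and applying a mean value inequality under the trace bounds `E tr Ĝ^(2r+2)` by a
multiple of `(2r+1)R · E tr((Ĝ + 2nI) Ĝ^(2r))`. This is self-bounding, so `E tr Ĝ^(2r+2) ≤ p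
(32(r+1)Rn)^(r+1)`; with `r + 1` of order `log p`, Markov's inequality gives operator norm of order
`√(n R log p)` (`measure_centredGram_bilin_le`). Divided by `n` this is the rate without its factor
`√(1 + K₀²)`. -/

noncomputable section

namespace LSWrongModel

open Matrix

/-! ### Traces involving differences of rank one matrices -/

section RankOne

variable {ι : Type*} [Fintype ι]

theorem dotProduct_self_nonneg (v : ι → ℝ) : 0 ≤ v ⬝ᵥ v :=
  Finset.sum_nonneg fun i _ => mul_self_nonneg (v i)

theorem trace_vecMulVec_mul (v w : ι → ℝ) (G : Matrix ι ι ℝ) :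
    (vecMulVec v w * G).trace = w ⬝ᵥ G *ᵥ v := by
  rw [vecMulVec_mul, trace_vecMulVec, dotProduct_comm, dotProduct_mulVec]

/-- With `a = Hv` and `b = Hw`, twice the sum of the square terms minus the expanded trace is the
squared Frobenius norm of `v aᵀ + w bᵀ`. This is the matrix form of `(x - y)² ≤ 2(x² + y²)`. -/
theorem trace_sq_rankOne_sub_mul_le {H : Matrix ι ι ℝ} (hH : H.IsSymm) (v w : ι → ℝ) :
    ((vecMulVec v v - vecMulVec w w) * (vecMulVec v v - vecMulVec w w) * (H * H)).trace
      ≤ 2 * ((v ⬝ᵥ v) * (v ⬝ᵥ (H * H) *ᵥ v) + (w ⬝ᵥ w) * (w ⬝ᵥ (H * H) *ᵥ w)) := by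
  have hd : ∀ x y : ι → ℝ, x ⬝ᵥ (H * H) *ᵥ y = (H *ᵥ x) ⬝ᵥ (H *ᵥ y) := by
    intro x y
    rw [← mulVec_mulVec, dotProduct_mulVec, ← mulVec_transpose, hH.eq]
  have hm : ∀ x y : ι → ℝ, (vecMulVec x x * vecMulVec y y * (H * H)).trace
      = (x ⬝ᵥ y) * ((H *ᵥ x) ⬝ᵥ (H *ᵥ y)) := by
    intro x y
    rw [vecMulVec_mul_vecMulVec, vecMulVec_smul, Matrix.smul_mul, trace_smul, trace_vecMulVec_mul,
      hd, smul_eq_mul, dotProduct_comm (H *ᵥ y)]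
  simp only [Matrix.sub_mul, Matrix.mul_sub, Matrix.trace_sub, hm, hd]
  set a := H *ᵥ v
  set b := H *ᵥ w
  have key : 0 ≤ (v ⬝ᵥ v) * (a ⬝ᵥ a) + 2 * ((v ⬝ᵥ w) * (a ⬝ᵥ b)) + (w ⬝ᵥ w) * (b ⬝ᵥ b) := by
    have : (v ⬝ᵥ v) * (a ⬝ᵥ a) + 2 * ((v ⬝ᵥ w) * (a ⬝ᵥ b)) + (w ⬝ᵥ w) * (b ⬝ᵥ b)
        = ∑ i, ∑ j, (v i * a j + w i * b j) ^ 2 := by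
      simp only [dotProduct, Finset.sum_mul_sum]
      simp only [Finset.mul_sum, ← Finset.sum_add_distrib]
      exact Finset.sum_congr rfl fun i _ => Finset.sum_congr rfl fun j _ => by ring
    rw [this]
    positivity
  rw [dotProduct_comm w v, dotProduct_comm b a]
  linarith

end RankOne

/-! ### Spectral calculus under the trace -/

section Spectral

variable {ι : Type*} [Fintype ι] [DecidableEq ι]

theorem exists_orthogonal_diagonalization {P : Matrix ι ι ℝ} (hP : P.IsSymm) :
    ∃ (U : Matrix ι ι ℝ) (d : ι → ℝ), U * Uᵀ = 1 ∧ Uᵀ * U = 1 ∧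
      (∀ i, d i ∈ spectrum ℝ P) ∧ ∀ k : ℕ, P ^ k = U * diagonal (fun i => d i ^ k) * Uᵀ := by
  have hH : P.IsHermitian := by
    rw [Matrix.IsHermitian, conjTranspose_eq_transpose_of_trivial]; exact hP
  have h1 : (hH.eigenvectorUnitary : Matrix ι ι ℝ)
      * (hH.eigenvectorUnitary : Matrix ι ι ℝ)ᵀ = 1 := by
    have := Unitary.coe_mul_star_self hH.eigenvectorUnitary
    rwa [Unitary.coe_star, star_eq_conjTranspose, conjTranspose_eq_transpose_of_trivial] at this
  have h2 : (hH.eigenvectorUnitary : Matrix ι ι ℝ)ᵀ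
      * (hH.eigenvectorUnitary : Matrix ι ι ℝ) = 1 := by
    have := Unitary.coe_star_mul_self hH.eigenvectorUnitary
    rwa [star_eq_conjTranspose, conjTranspose_eq_transpose_of_trivial] at this
  have h3 : P = (hH.eigenvectorUnitary : Matrix ι ι ℝ) * diagonal hH.eigenvalues
      * (hH.eigenvectorUnitary : Matrix ι ι ℝ)ᵀ := by
    have := hH.spectral_theorem
    rw [Unitary.conjStarAlgAut_apply, star_eq_conjTranspose,
      conjTranspose_eq_transpose_of_trivial] at this
    exact this
  refine ⟨hH.eigenvectorUnitary, hH.eigenvalues, h1, h2,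
    fun i => hH.spectrum_real_eq_range_eigenvalues ▸ ⟨i, rfl⟩, fun k => ?_⟩
  induction k with
  | zero => simp [h1]
  | succ k ih =>
    rw [pow_succ, ih]
    generalize (hH.eigenvectorUnitary : Matrix ι ι ℝ) = U at *
    calc U * diagonal (fun i => hH.eigenvalues i ^ k) * Uᵀ * P
        = U * diagonal (fun i => hH.eigenvalues i ^ k) * Uᵀ * (U * diagonal hH.eigenvalues * Uᵀ) :=
          congrArg _ h3
      _ = U * (diagonal (fun i => hH.eigenvalues i ^ k) * (Uᵀ * U) * diagonal hH.eigenvalues)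
          * Uᵀ := by simp only [Matrix.mul_assoc]
      _ = _ := by rw [h2, Matrix.mul_one, diagonal_mul_diagonal]; simp only [pow_succ]

/-- The weights are the squared inner products between the eigenvectors of `P` and those of `Q`.
They turn trace inequalities for two noncommuting matrices into scalar inequalities for pairs of
eigenvalues. -/
theorem exists_joint_spectral_weights {P Q : Matrix ι ι ℝ} (hP : P.IsSymm) (hQ : Q.IsSymm) :
    ∃ (d e : ι → ℝ) (c : ι → ι → ℝ), (∀ i j, 0 ≤ c i j) ∧
      ∀ a b : ℕ, (P ^ a * Q ^ b).trace = ∑ i, ∑ j, c i j * (d i ^ a * e j ^ b) := by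
  obtain ⟨U, d, hU1, hU2, -, hU⟩ := exists_orthogonal_diagonalization hP
  obtain ⟨V, e, hV1, hV2, -, hV⟩ := exists_orthogonal_diagonalization hQ
  refine ⟨d, e, fun i j => ((Uᵀ * V) i j) ^ 2, fun i j => sq_nonneg _, fun a b => ?_⟩
  rw [hU, hV]
  have : (U * diagonal (fun i => d i ^ a) * Uᵀ * (V * diagonal (fun i => e i ^ b) * Vᵀ)).trace
      = (diagonal (fun i => d i ^ a) * (Uᵀ * V) * diagonal (fun i => e i ^ b) * (Uᵀ * V)ᵀ).trace := by
    rw [transpose_mul, transpose_transpose, ← Matrix.mul_assoc _ Vᵀ U, Matrix.trace_mul_comm _ U]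
    simp only [Matrix.mul_assoc]
  rw [this, Matrix.trace]
  refine Finset.sum_congr rfl fun i _ => ?_
  rw [Matrix.diag_apply, Matrix.mul_apply]
  refine Finset.sum_congr rfl fun j _ => ?_
  rw [Matrix.mul_diagonal, Matrix.diagonal_mul, Matrix.transpose_apply]
  ring

theorem pow_mul_pow_le_add (a b : ℝ) {i j r : ℕ} (h : i + j = 2 * r) :
    a ^ i * b ^ j ≤ a ^ (2 * r) + b ^ (2 * r) := by
  have key : ∀ x y : ℝ, |x| ≤ |y| → x ^ i * y ^ j ≤ y ^ (2 * r) := by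
    intro x y hxy
    calc x ^ i * y ^ j ≤ |x ^ i * y ^ j| := le_abs_self _
      _ = |x| ^ i * |y| ^ j := by rw [abs_mul, abs_pow, abs_pow]
      _ ≤ |y| ^ i * |y| ^ j := by gcongr
      _ = y ^ (2 * r) := by rw [← pow_add, h, pow_mul, sq_abs, ← pow_mul]
  have key' : ∀ x y : ℝ, |y| ≤ |x| → x ^ i * y ^ j ≤ x ^ (2 * r) := by
    intro x y hxy
    calc x ^ i * y ^ j ≤ |x ^ i * y ^ j| := le_abs_self _
      _ = |x| ^ i * |y| ^ j := by rw [abs_mul, abs_pow, abs_pow]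
      _ ≤ |x| ^ i * |x| ^ j := by gcongr
      _ = x ^ (2 * r) := by rw [← pow_add, h, pow_mul, sq_abs, ← pow_mul]
  have ha : 0 ≤ a ^ (2 * r) := by rw [pow_mul]; positivity
  have hb : 0 ≤ b ^ (2 * r) := by rw [pow_mul]; positivity
  rcases le_total |a| |b| with hab | hab
  · linarith [key a b hab]
  · linarith [key' a b hab]

/-- Factoring `a - b` out of the difference of powers leaves `2r + 1` monomials of even degree `2r`,
each at most the larger of the two pure powers. The odd exponent is what makes this work for
eigenvalues of either sign. -/
theorem sub_mul_pow_sub_pow_le (a b : ℝ) (r : ℕ) :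
    (a - b) * (a ^ (2 * r + 1) - b ^ (2 * r + 1))
      ≤ (2 * r + 1 : ℕ) * ((a - b) ^ 2 * (a ^ (2 * r) + b ^ (2 * r))) := by
  have h := (Commute.all a b).geom_sum₂_mul (2 * r + 1)
  rw [← h]
  have hs : ∑ i ∈ Finset.range (2 * r + 1), a ^ i * b ^ (2 * r + 1 - 1 - i)
      ≤ (2 * r + 1 : ℕ) * (a ^ (2 * r) + b ^ (2 * r)) := by
    calc _ ≤ ∑ i ∈ Finset.range (2 * r + 1), (a ^ (2 * r) + b ^ (2 * r)) := by
          refine Finset.sum_le_sum fun i hi => pow_mul_pow_le_add a b ?_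
          have := Finset.mem_range.1 hi
          omega
      _ = _ := by simp [mul_add]
  calc _ = (a - b) ^ 2 * ∑ i ∈ Finset.range (2 * r + 1), a ^ i * b ^ (2 * r + 1 - 1 - i) := by ring
    _ ≤ (a - b) ^ 2 * ((2 * r + 1 : ℕ) * (a ^ (2 * r) + b ^ (2 * r))) :=
        mul_le_mul_of_nonneg_left hs (sq_nonneg _)
    _ = _ := by ring

/-- A mean value inequality for odd powers under the trace. -/
theorem trace_sub_mul_pow_sub_pow_le {P Q : Matrix ι ι ℝ} (hP : P.IsSymm) (hQ : Q.IsSymm) (r : ℕ) :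
    ((P - Q) * (P ^ (2 * r + 1) - Q ^ (2 * r + 1))).trace
      ≤ (2 * r + 1 : ℕ) * ((P - Q) * (P - Q) * (P ^ (2 * r) + Q ^ (2 * r))).trace := by
  obtain ⟨d, e, c, hc, h⟩ := exists_joint_spectral_weights hP hQ
  have e1 : ((P - Q) * (P ^ (2 * r + 1) - Q ^ (2 * r + 1))).trace
      = ∑ i, ∑ j, c i j * ((d i - e j) * (d i ^ (2 * r + 1) - e j ^ (2 * r + 1))) := by
    have : ((P - Q) * (P ^ (2 * r + 1) - Q ^ (2 * r + 1))).trace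
        = (P ^ (2 * r + 2) * Q ^ 0).trace - (P ^ (2 * r + 1) * Q ^ 1).trace
          - (P ^ 1 * Q ^ (2 * r + 1)).trace + (P ^ 0 * Q ^ (2 * r + 2)).trace := by
      rw [Matrix.sub_mul, Matrix.mul_sub, Matrix.mul_sub, Matrix.trace_sub, Matrix.trace_sub,
        Matrix.trace_sub, Matrix.trace_mul_comm Q (P ^ (2 * r + 1)), ← pow_succ', ← pow_succ']
      simp only [pow_zero, pow_one, Matrix.mul_one, Matrix.one_mul]
      ring
    rw [this, h, h, h, h, ← Finset.sum_sub_distrib, ← Finset.sum_sub_distrib,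
      ← Finset.sum_add_distrib]
    refine Finset.sum_congr rfl fun i _ => ?_
    rw [← Finset.sum_sub_distrib, ← Finset.sum_sub_distrib, ← Finset.sum_add_distrib]
    refine Finset.sum_congr rfl fun j _ => ?_
    ring
  have e2 : ((P - Q) * (P - Q) * (P ^ (2 * r) + Q ^ (2 * r))).trace
      = ∑ i, ∑ j, c i j * ((d i - e j) ^ 2 * (d i ^ (2 * r) + e j ^ (2 * r))) := by
    have : ((P - Q) * (P - Q) * (P ^ (2 * r) + Q ^ (2 * r))).trace
        = (P ^ (2 * r + 2) * Q ^ 0).trace - 2 * (P ^ (2 * r + 1) * Q ^ 1).trace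
          + (P ^ (2 * r) * Q ^ 2).trace + (P ^ 2 * Q ^ (2 * r)).trace
          - 2 * (P ^ 1 * Q ^ (2 * r + 1)).trace + (P ^ 0 * Q ^ (2 * r + 2)).trace := by
      have a1 : (P * P * P ^ (2 * r)).trace = (P ^ (2 * r + 2)).trace := by
        rw [pow_add, ← (Commute.refl P).pow_left 2 |>.pow_right (2*r), pow_two]
      have a2 : (P * Q * P ^ (2 * r)).trace = (P ^ (2 * r + 1) * Q).trace := by
        rw [Matrix.mul_assoc, Matrix.trace_mul_comm, Matrix.mul_assoc, Matrix.trace_mul_comm,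
          pow_succ]
      have a3 : (Q * P * P ^ (2 * r)).trace = (P ^ (2 * r + 1) * Q).trace := by
        rw [Matrix.mul_assoc, Matrix.trace_mul_comm, ← pow_succ']
      have a4 : (Q * Q * P ^ (2 * r)).trace = (P ^ (2 * r) * Q ^ 2).trace := by
        rw [Matrix.trace_mul_comm, pow_two]
      have a5 : (P * Q * Q ^ (2 * r)).trace = (P * Q ^ (2 * r + 1)).trace := by
        rw [Matrix.mul_assoc, ← pow_succ']
      have a6 : (Q * P * Q ^ (2 * r)).trace = (P * Q ^ (2 * r + 1)).trace := by
        rw [Matrix.mul_assoc, Matrix.trace_mul_comm, Matrix.mul_assoc, ← pow_succ]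
      have a7 : (Q * Q * Q ^ (2 * r)).trace = (Q ^ (2 * r + 2)).trace := by
        rw [pow_add, ← (Commute.refl Q).pow_left 2 |>.pow_right (2*r), pow_two]
      simp only [Matrix.sub_mul, Matrix.mul_sub, Matrix.mul_add, Matrix.trace_sub,
        Matrix.trace_add, a1, a2, a3, a4, a5, a6, a7]
      simp only [pow_zero, pow_one, Matrix.mul_one, Matrix.one_mul]
      rw [pow_two P]
      ring
    rw [this, h, h, h, h, h, h, Finset.mul_sum, Finset.mul_sum, ← Finset.sum_sub_distrib,
      ← Finset.sum_add_distrib, ← Finset.sum_add_distrib, ← Finset.sum_sub_distrib,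
      ← Finset.sum_add_distrib]
    refine Finset.sum_congr rfl fun i _ => ?_
    rw [Finset.mul_sum, Finset.mul_sum, ← Finset.sum_sub_distrib,
      ← Finset.sum_add_distrib, ← Finset.sum_add_distrib, ← Finset.sum_sub_distrib,
      ← Finset.sum_add_distrib]
    refine Finset.sum_congr rfl fun j _ => ?_
    ring
  rw [e1, e2, Finset.mul_sum]
  refine Finset.sum_le_sum fun i _ => ?_
  rw [Finset.mul_sum]
  refine Finset.sum_le_sum fun j _ => ?_
  calc _ ≤ c i j * ((2 * r + 1 : ℕ) * ((d i - e j) ^ 2 * (d i ^ (2 * r) + e j ^ (2 * r)))) :=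
        mul_le_mul_of_nonneg_left (sub_mul_pow_sub_pow_le _ _ r) (hc i j)
    _ = _ := by ring

/-- The trace of a symmetric matrix power, read off the spectrum. -/
theorem exists_spectral_weights {P : Matrix ι ι ℝ} (hP : P.IsSymm) :
    ∃ d : ι → ℝ, ∀ k : ℕ, (P ^ k).trace = ∑ i, d i ^ k := by
  obtain ⟨U, d, hU1, hU2, -, hU⟩ := exists_orthogonal_diagonalization hP
  refine ⟨d, fun k => ?_⟩
  rw [hU, Matrix.trace_mul_comm, ← Matrix.mul_assoc, hU2, Matrix.one_mul, trace_diagonal]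

theorem trace_pow_even_nonneg {P : Matrix ι ι ℝ} (hP : P.IsSymm) (q : ℕ) :
    0 ≤ (P ^ (2 * q)).trace := by
  obtain ⟨d, hd⟩ := exists_spectral_weights hP
  rw [hd]
  exact Finset.sum_nonneg fun i _ => by rw [pow_mul]; positivity

/-- The operator norm of a symmetric matrix is at most its Schatten norm of even order. -/
theorem abs_bilin_le_of_trace_pow_le {P : Matrix ι ι ℝ} (hP : P.IsSymm) {q : ℕ} (hq : q ≠ 0) {s : ℝ}
    (hs : 0 ≤ s) (h : (P ^ (2 * q)).trace ≤ s ^ (2 * q)) (x y : ι → ℝ) :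
    |x ⬝ᵥ P *ᵥ y| ≤ s * (√(x ⬝ᵥ x) * √(y ⬝ᵥ y)) := by
  obtain ⟨U, d, hU1, hU2, -, hU⟩ := exists_orthogonal_diagonalization hP
  have htr : (P ^ (2 * q)).trace = ∑ i, d i ^ (2 * q) := by
    rw [hU, Matrix.trace_mul_comm, ← Matrix.mul_assoc, hU2, Matrix.one_mul, trace_diagonal]
  have hd : ∀ i, |d i| ≤ s := by
    intro i
    have h1 : d i ^ (2 * q) ≤ s ^ (2 * q) := by
      refine le_trans ?_ (htr ▸ h)
      exact Finset.single_le_sum (f := fun i => d i ^ (2 * q))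
        (fun j _ => by rw [pow_mul]; positivity) (Finset.mem_univ i)
    have h2 : |d i| ^ (2 * q) ≤ s ^ (2 * q) := by
      rwa [pow_mul, sq_abs, ← pow_mul]
    exact le_of_pow_le_pow_left₀ (by omega) hs h2
  have hnorm : ∀ z : ι → ℝ, (Uᵀ *ᵥ z) ⬝ᵥ (Uᵀ *ᵥ z) = z ⬝ᵥ z := by
    intro z
    rw [dotProduct_mulVec, vecMul_transpose, mulVec_mulVec, hU1, one_mulVec]
  have hP1 : P = U * diagonal d * Uᵀ := by simpa using hU 1
  have hb : x ⬝ᵥ P *ᵥ y = ∑ i, d i * ((Uᵀ *ᵥ x) i * (Uᵀ *ᵥ y) i) := by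
    rw [hP1, ← mulVec_mulVec, ← mulVec_mulVec, dotProduct_mulVec, ← mulVec_transpose]
    simp only [dotProduct, mulVec_diagonal]
    exact Finset.sum_congr rfl fun i _ => by ring
  rw [hb, ← hnorm x, ← hnorm y]
  set x' := Uᵀ *ᵥ x
  set y' := Uᵀ *ᵥ y
  calc |∑ i, d i * (x' i * y' i)| ≤ ∑ i, s * (|x' i| * |y' i|) := by
        refine (Finset.abs_sum_le_sum_abs _ _).trans (Finset.sum_le_sum fun i _ => ?_)
        rw [abs_mul, abs_mul]
        exact mul_le_mul_of_nonneg_right (hd i) (by positivity)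
    _ = s * ∑ i, |x' i| * |y' i| := by rw [Finset.mul_sum]
    _ ≤ s * (√(x' ⬝ᵥ x') * √(y' ⬝ᵥ y')) := by
        refine mul_le_mul_of_nonneg_left ?_ hs
        refine (Real.sum_mul_le_sqrt_mul_sqrt _ _ _).trans (le_of_eq ?_)
        simp only [sq_abs]
        simp only [dotProduct, pow_two]

end Spectral

/-! ### Second moment matrices of bounded random vectors -/

section SecondMoment

variable {ι : Type*} [Fintype ι]

/-- The integrands of the matrix moment argument are continuous functions of almost surely bounded
vectors, so compactness of closed balls settles their integrability. -/
theorem integrable_comp_of_continuous_of_bounded {Ω E : Type*} [MeasurableSpace Ω] {μ : Measure Ω}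
    [IsFiniteMeasure μ] [NormedAddCommGroup E] [ProperSpace E] [MeasurableSpace E] [BorelSpace E]
    {V : Ω → E} (hV : Measurable V) {C : ℝ} (hC : ∀ᵐ ω ∂μ, ‖V ω‖ ≤ C)
    {F : E → ℝ} (hF : Continuous F) : Integrable (fun ω => F (V ω)) μ := by
  obtain ⟨B, hB⟩ := (isCompact_closedBall (0 : E) C).exists_bound_of_continuousOn hF.continuousOn
  refine Integrable.of_bound (hF.measurable.comp hV).aestronglyMeasurable B ?_
  filter_upwards [hC] with ω hω
  exact hB _ (by simpa using hω)

theorem norm_le_sqrt_of_dotProduct_le {u : ι → ℝ} {R : ℝ} (h : u ⬝ᵥ u ≤ R) : ‖u‖ ≤ √R := by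
  rw [pi_norm_le_iff_of_nonneg (Real.sqrt_nonneg _)]
  intro i
  rw [Real.norm_eq_abs]
  refine Real.abs_le_sqrt (le_trans ?_ h)
  rw [pow_two]
  exact Finset.single_le_sum (f := fun i => u i * u i) (fun j _ => mul_self_nonneg _)
    (Finset.mem_univ i)

/-- The second moment matrix of a random vector. -/
def secondMoment (α : Measure (ι → ℝ)) : Matrix ι ι ℝ :=
  Matrix.of fun j k => ∫ u, u j * u k ∂α

theorem dotProduct_mulVec_self (u : ι → ℝ) (G : Matrix ι ι ℝ) :
    u ⬝ᵥ G *ᵥ u = ∑ j, ∑ k, G j k * (u j * u k) := by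
  simp only [dotProduct, mulVec, Finset.mul_sum]
  exact Finset.sum_congr rfl fun j _ => Finset.sum_congr rfl fun k _ => by ring

theorem integral_quadraticForm {α : Measure (ι → ℝ)} [IsFiniteMeasure α] {R : ℝ}
    (hR : ∀ᵐ u ∂α, u ⬝ᵥ u ≤ R) (G : Matrix ι ι ℝ) :
    ∫ u, u ⬝ᵥ G *ᵥ u ∂α = (secondMoment α * G).trace := by
  have hb : ∀ᵐ u ∂α, ‖u‖ ≤ √R := hR.mono fun u hu => norm_le_sqrt_of_dotProduct_le hu
  have hi : ∀ j k, Integrable (fun u : ι → ℝ => G j k * (u j * u k)) α := fun j k =>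
    integrable_comp_of_continuous_of_bounded (V := id) measurable_id hb
      (F := fun u : ι → ℝ => G j k * (u j * u k)) (by fun_prop)
  simp only [dotProduct_mulVec_self]
  rw [integral_finsetSum _ fun j _ => integrable_finsetSum _ fun k _ => hi j k]
  rw [Matrix.trace_mul_comm]
  simp only [Matrix.trace, Matrix.diag_apply, Matrix.mul_apply]
  refine Finset.sum_congr rfl fun j _ => ?_
  rw [integral_finsetSum _ fun k _ => hi j k]
  refine Finset.sum_congr rfl fun k _ => ?_
  rw [integral_const_mul]
  simp only [secondMoment, Matrix.of_apply, mul_comm]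

end SecondMoment

theorem isSymm_vecMulVec_add {ι : Type*} {w : Matrix ι ι ℝ} (hw : w.IsSymm) (u : ι → ℝ) :
    (vecMulVec u u + w).IsSymm := by
  rw [Matrix.IsSymm, transpose_add, transpose_vecMulVec, hw.eq]

/-! ### Exchange with an independent copy -/

section Exchange

variable {ι : Type*} [Fintype ι] [DecidableEq ι]

/-- Exchanging one summand of a random matrix with an independent copy. -/
theorem integral_trace_exchange {α : Measure (ι → ℝ)} [IsProbabilityMeasure α] {R : ℝ}
    (hR : ∀ᵐ u ∂α, u ⬝ᵥ u ≤ R) {w : Matrix ι ι ℝ} (hw : w.IsSymm) (r : ℕ) :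
    ∫ u, ((vecMulVec u u - secondMoment α) * (vecMulVec u u + w) ^ (2 * r + 1)).trace ∂α
      ≤ (2 * (2 * r + 1 : ℕ) * R) *
        ∫ u, ((vecMulVec u u + secondMoment α) * (vecMulVec u u + w) ^ (2 * r)).trace ∂α := by
  have hb : ∀ᵐ u ∂α, ‖u‖ ≤ √R := hR.mono fun u hu => norm_le_sqrt_of_dotProduct_le hu
  have hR1 : ∀ᵐ z ∂α.prod α, z.1 ⬝ᵥ z.1 ≤ R := Measure.quasiMeasurePreserving_fst.ae hR
  have hR2 : ∀ᵐ z ∂α.prod α, z.2 ⬝ᵥ z.2 ≤ R := Measure.quasiMeasurePreserving_snd.ae hR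
  have hb2 : ∀ᵐ z ∂α.prod α, ‖z‖ ≤ √R := by
    filter_upwards [hR1, hR2] with z h1 h2
    exact max_le (norm_le_sqrt_of_dotProduct_le h1) (norm_le_sqrt_of_dotProduct_le h2)
  have hint1 : ∀ {F : (ι → ℝ) → ℝ}, Continuous F → Integrable F α := fun hF =>
    integrable_comp_of_continuous_of_bounded measurable_id hb hF
  have hint2 : ∀ {F : (ι → ℝ) × (ι → ℝ) → ℝ}, Continuous F → Integrable F (α.prod α) := fun hF =>
    integrable_comp_of_continuous_of_bounded measurable_id hb2 hF
  set m := 2 * r + 1 with hm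
  set T : (ι → ℝ) → Matrix ι ι ℝ := fun u => vecMulVec u u + w with hT
  have hTs : ∀ u, (T u).IsSymm := isSymm_vecMulVec_add hw
  have hTc : Continuous T := by rw [hT]; fun_prop
  -- first moment of the exchanged difference
  have e1 : ∫ u, ((vecMulVec u u - secondMoment α) * T u ^ m).trace ∂α
      = ∫ z, ((vecMulVec z.1 z.1 - vecMulVec z.2 z.2) * T z.1 ^ m).trace ∂α.prod α := by
    rw [integral_prod _ (hint2 (by fun_prop))]
    refine integral_congr_ae (Eventually.of_forall fun u => ?_)
    simp only [Matrix.sub_mul, Matrix.trace_sub, trace_vecMulVec_mul]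
    rw [integral_sub (integrable_const _) (hint1 (by fun_prop)), integral_quadraticForm hR]
    simp
  have e2 : ∫ u, ((vecMulVec u u + secondMoment α) * T u ^ (2 * r)).trace ∂α
      = ∫ z, (z.1 ⬝ᵥ (T z.1 ^ (2 * r)) *ᵥ z.1 + z.2 ⬝ᵥ (T z.1 ^ (2 * r)) *ᵥ z.2) ∂α.prod α := by
    rw [integral_prod _ (hint2 (by fun_prop))]
    refine integral_congr_ae (Eventually.of_forall fun u => ?_)
    simp only [Matrix.add_mul, Matrix.trace_add, trace_vecMulVec_mul]
    rw [integral_add (integrable_const _) (hint1 (by fun_prop)), integral_quadraticForm hR]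
    simp
  set S : (ι → ℝ) × (ι → ℝ) → ℝ :=
    fun z => ((vecMulVec z.1 z.1 - vecMulVec z.2 z.2) * T z.1 ^ m).trace with hS
  set Q : (ι → ℝ) × (ι → ℝ) → ℝ :=
    fun z => z.1 ⬝ᵥ (T z.1 ^ (2 * r)) *ᵥ z.1 + z.2 ⬝ᵥ (T z.1 ^ (2 * r)) *ᵥ z.2 with hQ
  have hSi : Integrable S (α.prod α) := hint2 (by rw [hS]; fun_prop)
  have hQi : Integrable Q (α.prod α) := hint2 (by rw [hQ]; fun_prop)
  have sS : ∫ z, S z.swap ∂α.prod α = ∫ z, S z ∂α.prod α := integral_prod_swap S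
  have sQ : ∫ z, Q z.swap ∂α.prod α = ∫ z, Q z ∂α.prod α := integral_prod_swap Q
  have hSi' : Integrable (fun z => S z.swap) (α.prod α) := hSi.swap
  have hQi' : Integrable (fun z => Q z.swap) (α.prod α) := hQi.swap
  -- Swapping the two copies preserves the product law and changes the sign of the first factor of
  -- `S`. The sum with the swap is therefore a trace of `(P - Q)(P^m - Q^m)`, to which the mean
  -- value inequality applies.
  have hmono : ∫ z, (S z + S z.swap) ∂α.prod α
      ≤ ∫ z, (2 * m * R) * (Q z + Q z.swap) ∂α.prod α := by
    refine integral_mono_ae (hSi.add hSi') ((hQi.add hQi').const_mul _) ?_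
    filter_upwards [hR1, hR2] with z h1 h2
    have hd : vecMulVec z.1 z.1 - vecMulVec z.2 z.2 = T z.1 - T z.2 := by simp [hT]
    have hs : S z + S z.swap = ((T z.1 - T z.2) * (T z.1 ^ m - T z.2 ^ m)).trace := by
      simp only [hS, Prod.fst_swap, Prod.snd_swap]
      rw [← neg_sub (vecMulVec z.1 z.1) (vecMulVec z.2 z.2), hd, Matrix.mul_sub, Matrix.neg_mul,
        Matrix.trace_neg, Matrix.trace_sub]
      ring
    have hsq : ∀ u, T u ^ (2 * r) = T u ^ r * T u ^ r := fun u => by rw [two_mul, pow_add]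
    have hnn : ∀ u v, 0 ≤ v ⬝ᵥ (T u ^ (2 * r)) *ᵥ v := by
      intro u v
      rw [hsq, ← mulVec_mulVec, dotProduct_mulVec, ← mulVec_transpose, ((hTs u).pow r).eq]
      exact dotProduct_self_nonneg _
    have hpart : ∀ u, ((T z.1 - T z.2) * (T z.1 - T z.2) * T u ^ (2 * r)).trace
        ≤ 2 * R * (z.1 ⬝ᵥ (T u ^ (2 * r)) *ᵥ z.1 + z.2 ⬝ᵥ (T u ^ (2 * r)) *ᵥ z.2) := by
      intro u
      have := trace_sq_rankOne_sub_mul_le ((hTs u).pow r) z.1 z.2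
      rw [← hsq, hd] at this
      refine this.trans ?_
      have i1 := mul_le_mul_of_nonneg_right h1 (hnn u z.1)
      have i2 := mul_le_mul_of_nonneg_right h2 (hnn u z.2)
      linarith
    have hmain := trace_sub_mul_pow_sub_pow_le (hTs z.1) (hTs z.2) r
    rw [Matrix.mul_add, Matrix.trace_add] at hmain
    change S z + S z.swap ≤ _
    rw [hs]
    refine hmain.trans ?_
    have h3 := add_le_add (hpart z.1) (hpart z.2)
    have h4 := mul_le_mul_of_nonneg_left h3 (Nat.cast_nonneg (α := ℝ) m)
    refine h4.trans (le_of_eq ?_)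
    simp only [hQ, Prod.fst_swap, Prod.snd_swap]
    ring
  rw [integral_add hSi hSi', integral_const_mul, integral_add hQi hQi', sS, sQ] at hmono
  rw [e1, e2]
  linarith

/-- Exchanging one of two independent parts of a random matrix. -/
theorem integral_trace_exchange_of_indepFun {Ω E : Type*} [MeasurableSpace Ω] {μ : Measure Ω}
    [IsProbabilityMeasure μ] [NormedAddCommGroup E] [ProperSpace E] [MeasurableSpace E]
    [BorelSpace E] [SecondCountableTopology E] {U : Ω → ι → ℝ} (hU : Measurable U) {R : ℝ}
    (hR : ∀ᵐ ω ∂μ, U ω ⬝ᵥ U ω ≤ R) {N : Ω → E} (hN : Measurable N) {B : ℝ}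
    (hB : ∀ᵐ ω ∂μ, ‖N ω‖ ≤ B) (hUN : IndepFun U N μ)
    {g : E → Matrix ι ι ℝ} (hg : Continuous g) (hgs : ∀ x, (g x).IsSymm) (r : ℕ) :
    ∫ ω, ((vecMulVec (U ω) (U ω) - secondMoment (μ.map U)) *
        (vecMulVec (U ω) (U ω) + g (N ω)) ^ (2 * r + 1)).trace ∂μ
      ≤ (2 * (2 * r + 1 : ℕ) * R) *
        ∫ ω, ((vecMulVec (U ω) (U ω) + secondMoment (μ.map U)) *
          (vecMulVec (U ω) (U ω) + g (N ω)) ^ (2 * r)).trace ∂μ := by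
  have : IsProbabilityMeasure (μ.map U) := Measure.isProbabilityMeasure_map hU.aemeasurable
  have : IsProbabilityMeasure (μ.map N) := Measure.isProbabilityMeasure_map hN.aemeasurable
  have hlaw := (indepFun_iff_map_prod_eq_prod_map_map hU.aemeasurable hN.aemeasurable).1 hUN
  have hb : ∀ᵐ ω ∂μ, ‖(U ω, N ω)‖ ≤ max (√R) B := by
    filter_upwards [hR, hB] with ω h1 h2
    exact max_le_max (norm_le_sqrt_of_dotProduct_le h1) h2
  have hR' : ∀ᵐ u ∂μ.map U, u ⬝ᵥ u ≤ R := by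
    rw [ae_map_iff hU.aemeasurable]
    · exact hR
    · exact measurableSet_le (by fun_prop) measurable_const
  have hkey : ∀ {F : (ι → ℝ) × E → ℝ}, Continuous F →
      Integrable F ((μ.map U).prod (μ.map N)) ∧
      ∫ ω, F (U ω, N ω) ∂μ = ∫ x, ∫ u, F (u, x) ∂μ.map U ∂μ.map N := by
    intro F hF
    have hi : Integrable F ((μ.map U).prod (μ.map N)) := by
      rw [← hlaw, integrable_map_measure hF.aestronglyMeasurable (hU.prodMk hN).aemeasurable]
      exact integrable_comp_of_continuous_of_bounded (hU.prodMk hN) hb hF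
    refine ⟨hi, ?_⟩
    rw [← integral_prod_symm _ hi, ← hlaw, integral_map (hU.prodMk hN).aemeasurable
      hF.aestronglyMeasurable]
  set C := secondMoment (μ.map U)
  obtain ⟨i1, e1⟩ := hkey (F := fun z => ((vecMulVec z.1 z.1 - C) *
    (vecMulVec z.1 z.1 + g z.2) ^ (2 * r + 1)).trace) (by fun_prop)
  obtain ⟨i2, e2⟩ := hkey (F := fun z => ((vecMulVec z.1 z.1 + C) *
    (vecMulVec z.1 z.1 + g z.2) ^ (2 * r)).trace) (by fun_prop)
  simp only at e1 e2
  rw [e1, e2, ← integral_const_mul]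
  exact integral_mono i1.integral_prod_right (i2.integral_prod_right.const_mul _)
    fun x => integral_trace_exchange hR' (hgs x) r

end Exchange

/-! ### Trace moments and operator norm of the centred Gram matrix -/

section Moment

/-- With `k = 4(r+1)R`, `A = 8kn` and `M = max(x², A)`, both `k|x|` and `2kn` are at most `M/4`, so
the left side is at most `M^(r+1)/2`. The lower bound on `n` makes `16k² ≤ A`, which handles small
`|x|`. -/
theorem self_bounding_pow_le {R n x : ℝ} (hR : 0 ≤ R) (r : ℕ) (hn : 8 * (r + 1 : ℕ) * R ≤ n) :
    (2 * (2 * r + 1 : ℕ) * R) * (x ^ (2 * r + 1) + 2 * n * x ^ (2 * r))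
      ≤ (x ^ (2 * (r + 1)) + (32 * (r + 1 : ℕ) * R * n) ^ (r + 1)) / 2 := by
  set k : ℝ := 4 * (r + 1 : ℕ) * R with hk
  have hk0 : 0 ≤ k := by positivity
  have hn' : 2 * k ≤ n := by rw [hk]; linarith
  have hn0 : 0 ≤ n := by linarith
  have hA : 32 * (r + 1 : ℕ) * R * n = 8 * k * n := by rw [hk]; ring
  rw [hA]
  set A := 8 * k * n with hAd
  have hA0 : 0 ≤ A := by positivity
  have hAk : 16 * k ^ 2 ≤ A := by rw [hAd]; nlinarith
  have hmk : 2 * (2 * r + 1 : ℕ) * R ≤ k := by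
    rw [hk]; push_cast; nlinarith
  have hx2 : 0 ≤ x ^ 2 := sq_nonneg x
  have h1 : k * |x| ≤ max (x ^ 2) A / 4 := by
    rcases le_total (4 * k) |x| with h | h
    · have : 4 * k * |x| ≤ |x| * |x| := mul_le_mul_of_nonneg_right h (abs_nonneg x)
      have h2 : |x| * |x| = x ^ 2 := by rw [← pow_two, sq_abs]
      have := le_max_left (x ^ 2) A
      linarith
    · have : k * |x| ≤ k * (4 * k) := mul_le_mul_of_nonneg_left h hk0
      have := le_max_right (x ^ 2) A
      nlinarith
  have h2 : 2 * k * n ≤ max (x ^ 2) A / 4 := by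
    have := le_max_right (x ^ 2) A
    rw [hAd] at this ⊢
    linarith
  set Mx := max (x ^ 2) A
  have hMx0 : 0 ≤ Mx := le_max_of_le_right hA0
  have hp0 : 0 ≤ x ^ (2 * r) := by rw [pow_mul]; positivity
  have hp : x ^ (2 * r) ≤ Mx ^ r := by
    rw [pow_mul]
    exact pow_le_pow_left₀ hx2 (le_max_left _ _) r
  have hxn : x + 2 * n ≤ |x| + 2 * n := by linarith [le_abs_self x]
  have hMp : Mx ^ (r + 1) ≤ x ^ (2 * (r + 1)) + A ^ (r + 1) := by
    rw [pow_mul]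
    have := pow_nonneg hx2 (r + 1)
    have := pow_nonneg hA0 (r + 1)
    rcases max_choice (x ^ 2) A with h | h <;> simp only [Mx, h] <;> linarith
  calc (2 * (2 * r + 1 : ℕ) * R) * (x ^ (2 * r + 1) + 2 * n * x ^ (2 * r))
      = (2 * (2 * r + 1 : ℕ) * R) * (x + 2 * n) * x ^ (2 * r) := by ring
    _ ≤ (2 * (2 * r + 1 : ℕ) * R) * (|x| + 2 * n) * x ^ (2 * r) := by gcongr
    _ ≤ k * (|x| + 2 * n) * x ^ (2 * r) := by gcongr
    _ ≤ Mx / 2 * x ^ (2 * r) := by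
        refine mul_le_mul_of_nonneg_right ?_ hp0
        linarith
    _ ≤ Mx / 2 * Mx ^ r := mul_le_mul_of_nonneg_left hp (by linarith)
    _ = Mx ^ (r + 1) / 2 := by ring
    _ ≤ _ := by linarith

section Basic

variable {ι κ Ω : Type*} [Fintype κ] [MeasurableSpace Ω] {μ : Measure Ω} [IsProbabilityMeasure μ]

/-- Markov's inequality, in a form that covers a vanishing mean. -/
theorem measure_mul_lt_le {f : Ω → ℝ} (hf0 : ∀ ω, 0 ≤ f ω) (hf : Integrable f μ) {c s : ℝ}
    (hc : ∫ ω, f ω ∂μ ≤ c) (hs : 0 < s) : μ {ω | s * c < f ω} ≤ ENNReal.ofReal (1 / s) := by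
  have hI : 0 ≤ ∫ ω, f ω ∂μ := integral_nonneg hf0
  rcases (hI.trans hc).eq_or_lt with h0 | h0
  · have hz : f =ᵐ[μ] 0 := (integral_eq_zero_iff_of_nonneg hf0 hf).1 (by linarith)
    have : μ {ω | s * c < f ω} = 0 := by
      rw [measure_eq_zero_iff_ae_notMem]
      filter_upwards [hz] with ω hω
      simp [hω, ← h0]
    simp [this]
  · have h := mul_meas_ge_le_integral_of_nonneg (Eventually.of_forall hf0) hf (s * c)
    have hle : μ.real {ω | s * c ≤ f ω} ≤ 1 / s := by
      rw [le_div_iff₀ hs]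
      have : s * c * μ.real {ω | s * c ≤ f ω} ≤ c := h.trans hc
      nlinarith
    calc μ {ω | s * c < f ω} ≤ μ {ω | s * c ≤ f ω} := measure_mono fun ω (hω : s * c < f ω) => hω.le
      _ = ENNReal.ofReal (μ.real {ω | s * c ≤ f ω}) := by simp
      _ ≤ _ := ENNReal.ofReal_le_ofReal hle

/-- Fixes the moment order at `r + 1 = ⌈log p⌉`, so that the dimension factor `p` of the trace costs
only a constant after taking roots. The factor 3 absorbs the rounding, because `log p ≥ log 2 >
1/2`. -/
theorem exists_nat_log_le {p : ℕ} (hp : 2 ≤ p) :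
    ∃ r : ℕ, (p : ℝ) ≤ Real.exp 1 ^ (r + 1) ∧ ((r + 1 : ℕ) : ℝ) ≤ 3 * Real.log p := by
  have hp' : (2 : ℝ) ≤ p := by exact_mod_cast hp
  have hlog : Real.log 2 ≤ Real.log p := Real.log_le_log (by norm_num) hp'
  have h2 := Real.log_two_gt_d9
  have h0 : 0 < Real.log p := by linarith
  refine ⟨⌈Real.log p⌉₊ - 1, ?_, ?_⟩
  · rw [Nat.sub_add_cancel (Nat.one_le_iff_ne_zero.2 (Nat.ceil_pos.2 h0).ne'),
      ← Real.exp_nat_mul, mul_one]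
    calc (p : ℝ) = Real.exp (Real.log p) := (Real.exp_log (by linarith)).symm
      _ ≤ _ := Real.exp_le_exp.2 (Nat.le_ceil _)
  · rw [Nat.sub_add_cancel (Nat.one_le_iff_ne_zero.2 (Nat.ceil_pos.2 h0).ne')]
    have := Nat.ceil_lt_add_one h0.le
    linarith

theorem integrable_of_continuous_of_dotProduct_le [Fintype ι] {v : κ → Ω → ι → ℝ}
    (hv : ∀ i, Measurable (v i)) {R : ℝ} (hR : ∀ i, ∀ᵐ ω ∂μ, v i ω ⬝ᵥ v i ω ≤ R) {F : (κ → ι → ℝ) → ℝ} (hF : Continuous F) :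
    Integrable (fun ω => F (fun k => v k ω)) μ := by
  refine integrable_comp_of_continuous_of_bounded (V := fun ω k => v k ω) (C := √R)
    (by fun_prop) ?_ hF
  filter_upwards [ae_all_iff.2 hR] with ω hω
  rw [pi_norm_le_iff_of_nonneg (Real.sqrt_nonneg _)]
  exact fun k => norm_le_sqrt_of_dotProduct_le (hω k)

variable [DecidableEq ι]

/-- The centred sum `∑ i, vᵢ vᵢᵀ - c I`. -/
def centredGram (c : ℝ) (v : κ → ι → ℝ) : Matrix ι ι ℝ :=
  ∑ i, vecMulVec (v i) (v i) - c • 1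

theorem isSymm_centredGram (c : ℝ) (v : κ → ι → ℝ) : (centredGram c v).IsSymm := by
  simp [centredGram, Matrix.IsSymm, transpose_sum, transpose_vecMulVec]

theorem continuous_centredGram (c : ℝ) :
    Continuous (centredGram c : (κ → ι → ℝ) → Matrix ι ι ℝ) := by
  unfold centredGram
  fun_prop

end Basic

variable {ι κ Ω : Type*} [Fintype ι] [DecidableEq ι] [Fintype κ]
  [MeasurableSpace Ω] {μ : Measure Ω} [IsProbabilityMeasure μ]

/-- The other summands and the centring form a symmetric matrix independent of `v i`, so the
exchange inequality applies. Identical distribution is not required: each summand is compared with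
its own second moment matrix. -/
theorem integral_trace_summand_le {v : κ → Ω → ι → ℝ} (hv : ∀ i, Measurable (v i)) {R : ℝ}
    (hR : ∀ i, ∀ᵐ ω ∂μ, v i ω ⬝ᵥ v i ω ≤ R) (hind : iIndepFun v μ) (c : ℝ) (r : ℕ) (i : κ) :
    ∫ ω, ((vecMulVec (v i ω) (v i ω) - secondMoment (μ.map (v i))) *
        centredGram c (fun k => v k ω) ^ (2 * r + 1)).trace ∂μ
      ≤ (2 * (2 * r + 1 : ℕ) * R) *
        ∫ ω, ((vecMulVec (v i ω) (v i ω) + secondMoment (μ.map (v i))) *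
          centredGram c (fun k => v k ω) ^ (2 * r)).trace ∂μ := by
  classical
  set T : Finset κ := Finset.univ.erase i
  have hd : Disjoint ({i} : Finset κ) T := by simp [T]
  have hind' : IndepFun (v i) (fun ω (k : T) => v k ω) μ := by
    have := hind.indepFun_finset {i} T hd hv
    exact this.comp (φ := fun x : ({i} : Finset κ) → ι → ℝ => x ⟨i, by simp⟩) (ψ := id)
      (measurable_pi_apply _) measurable_id
  have hsplit : ∀ ω, centredGram c (fun k => v k ω)
      = vecMulVec (v i ω) (v i ω) + centredGram c (fun k : T => v k ω) := by
    intro ω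
    unfold centredGram
    rw [Finset.sum_coe_sort T (fun k => vecMulVec (v k ω) (v k ω)), ← add_sub_assoc,
      Finset.add_sum_erase _ (fun k => vecMulVec (v k ω) (v k ω)) (Finset.mem_univ i)]
  simp only [hsplit]
  refine integral_trace_exchange_of_indepFun (hv i) (hR i) (N := fun ω (k : T) => v k ω)
    (B := √R) (by fun_prop) ?_ hind' (g := centredGram c) (continuous_centredGram c)
    (isSymm_centredGram c) r
  filter_upwards [ae_all_iff.2 hR] with ω hω
  rw [pi_norm_le_iff_of_nonneg (Real.sqrt_nonneg _)]
  exact fun k => norm_le_sqrt_of_dotProduct_le (hω k)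

/-- Moments of a sum of independent rank one matrices, in Schatten norm of even order. -/
theorem integral_trace_centredGram_pow_le {v : κ → Ω → ι → ℝ} (hv : ∀ i, Measurable (v i)) {R : ℝ}
    (hR0 : 0 ≤ R) (hR : ∀ i, ∀ᵐ ω ∂μ, v i ω ⬝ᵥ v i ω ≤ R) (hind : iIndepFun v μ) {n : ℝ}
    (hC : ∑ i, secondMoment (μ.map (v i)) = n • (1 : Matrix ι ι ℝ)) (r : ℕ)
    (hn : 8 * (r + 1 : ℕ) * R ≤ n) :
    ∫ ω, (centredGram n (fun k => v k ω) ^ (2 * (r + 1))).trace ∂μ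
      ≤ Fintype.card ι * (32 * (r + 1 : ℕ) * R * n) ^ (r + 1) := by
  set G : (κ → ι → ℝ) → Matrix ι ι ℝ := centredGram n with hG
  have hGc : Continuous G := continuous_centredGram n
  have hint : ∀ {F : (κ → ι → ℝ) → ℝ}, Continuous F → Integrable (fun ω => F (fun k => v k ω)) μ :=
    fun hF => integrable_of_continuous_of_dotProduct_le hv hR hF
  set C : κ → Matrix ι ι ℝ := fun i => secondMoment (μ.map (v i))
  have e1 : ∀ ω, (G (fun k => v k ω) ^ (2 * (r + 1))).trace
      = ∑ i, ((vecMulVec (v i ω) (v i ω) - C i) * G (fun k => v k ω) ^ (2 * r + 1)).trace := by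
    intro ω
    rw [← trace_sum, ← Finset.sum_mul, Finset.sum_sub_distrib, hC, mul_add, mul_one,
      pow_succ' _ (2 * r + 1)]
    rfl
  have e2 : ∀ ω, ∑ i, ((vecMulVec (v i ω) (v i ω) + C i) * G (fun k => v k ω) ^ (2 * r)).trace
      = (G (fun k => v k ω) ^ (2 * r + 1)).trace + 2 * n * (G (fun k => v k ω) ^ (2 * r)).trace := by
    intro ω
    have : ∑ i, (vecMulVec (v i ω) (v i ω) + C i) = G (fun k => v k ω) + (2 * n) • 1 := by
      rw [Finset.sum_add_distrib, hC, hG, centredGram, two_mul, add_smul]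
      abel
    rw [← trace_sum, ← Finset.sum_mul, this, add_mul, trace_add, ← pow_succ', smul_mul_assoc,
      one_mul, trace_smul, smul_eq_mul]
  -- The self-bounding inequality is applied to each eigenvalue and summed; the constant term picks
  -- up the dimension.
  have e3 : ∀ ω, (2 * (2 * r + 1 : ℕ) * R) *
      ((G (fun k => v k ω) ^ (2 * r + 1)).trace + 2 * n * (G (fun k => v k ω) ^ (2 * r)).trace)
      ≤ (G (fun k => v k ω) ^ (2 * (r + 1))).trace / 2
        + Fintype.card ι * (32 * (r + 1 : ℕ) * R * n) ^ (r + 1) / 2 := by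
    intro ω
    obtain ⟨d, hd⟩ := exists_spectral_weights (isSymm_centredGram n (fun k => v k ω))
    rw [hG, hd, hd, hd, Finset.mul_sum, ← Finset.sum_add_distrib, Finset.mul_sum]
    refine (Finset.sum_le_sum fun i _ => self_bounding_pow_le (x := d i) hR0 r hn).trans ?_
    rw [← Finset.sum_div, Finset.sum_add_distrib, Finset.sum_const, Finset.card_univ, nsmul_eq_mul,
      add_div]
  have i1 : ∀ i, Integrable (fun ω => ((vecMulVec (v i ω) (v i ω) - C i) *
      G (fun k => v k ω) ^ (2 * r + 1)).trace) μ := fun i =>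
    hint (F := fun x => ((vecMulVec (x i) (x i) - C i) * G x ^ (2 * r + 1)).trace) (by fun_prop)
  have i2 : ∀ i, Integrable (fun ω => ((vecMulVec (v i ω) (v i ω) + C i) *
      G (fun k => v k ω) ^ (2 * r)).trace) μ := fun i =>
    hint (F := fun x => ((vecMulVec (x i) (x i) + C i) * G x ^ (2 * r)).trace) (by fun_prop)
  have i3 : Integrable (fun ω => (G (fun k => v k ω) ^ (2 * (r + 1))).trace) μ :=
    hint (F := fun x => (G x ^ (2 * (r + 1))).trace) (by fun_prop)
  have i4 : Integrable (fun ω => (G (fun k => v k ω) ^ (2 * r + 1)).trace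
      + 2 * n * (G (fun k => v k ω) ^ (2 * r)).trace) μ :=
    hint (F := fun x => (G x ^ (2 * r + 1)).trace + 2 * n * (G x ^ (2 * r)).trace) (by fun_prop)
  have key : ∫ ω, (G (fun k => v k ω) ^ (2 * (r + 1))).trace ∂μ
      ≤ (∫ ω, (G (fun k => v k ω) ^ (2 * (r + 1))).trace ∂μ) / 2
        + Fintype.card ι * (32 * (r + 1 : ℕ) * R * n) ^ (r + 1) / 2 := by
    calc ∫ ω, (G (fun k => v k ω) ^ (2 * (r + 1))).trace ∂μ
        = ∑ i, ∫ ω, ((vecMulVec (v i ω) (v i ω) - C i) *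
            G (fun k => v k ω) ^ (2 * r + 1)).trace ∂μ := by
          rw [← integral_finsetSum _ fun i _ => i1 i]
          exact integral_congr_ae (Eventually.of_forall e1)
      _ ≤ ∑ i, (2 * (2 * r + 1 : ℕ) * R) * ∫ ω, ((vecMulVec (v i ω) (v i ω) + C i) *
            G (fun k => v k ω) ^ (2 * r)).trace ∂μ :=
          Finset.sum_le_sum fun i _ => integral_trace_summand_le hv hR hind n r i
      _ = (2 * (2 * r + 1 : ℕ) * R) * ∫ ω, ((G (fun k => v k ω) ^ (2 * r + 1)).trace
            + 2 * n * (G (fun k => v k ω) ^ (2 * r)).trace) ∂μ := by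
          rw [← Finset.mul_sum, ← integral_finsetSum _ fun i _ => i2 i]
          simp only [e2]
      _ = ∫ ω, (2 * (2 * r + 1 : ℕ) * R) * ((G (fun k => v k ω) ^ (2 * r + 1)).trace
            + 2 * n * (G (fun k => v k ω) ^ (2 * r)).trace) ∂μ := by rw [integral_const_mul]
      _ ≤ ∫ ω, ((G (fun k => v k ω) ^ (2 * (r + 1))).trace / 2
            + Fintype.card ι * (32 * (r + 1 : ℕ) * R * n) ^ (r + 1) / 2) ∂μ :=
          integral_mono (i4.const_mul _) ((i3.div_const _).add (integrable_const _)) e3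
      _ = _ := by
          rw [integral_add (i3.div_const _) (integrable_const _), integral_div]
          simp
  -- The moment reappears on the right with factor `1 / 2` and is absorbed.
  linarith

/-- Deviations of a sum of independent rank one matrices in operator norm. -/
theorem measure_centredGram_bilin_le {v : κ → Ω → ι → ℝ} (hv : ∀ i, Measurable (v i)) {R : ℝ}
    (hR0 : 0 ≤ R) (hR : ∀ i, ∀ᵐ ω ∂μ, v i ω ⬝ᵥ v i ω ≤ R) (hind : iIndepFun v μ) {n : ℝ}
    (hC : ∑ i, secondMoment (μ.map (v i)) = n • (1 : Matrix ι ι ℝ))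
    (hp : 2 ≤ Fintype.card ι) (hn : 24 * Real.log (Fintype.card ι) * R ≤ n) {t : ℝ} (ht : 2 ≤ t) :
    μ {ω | ¬ ∀ x y : ι → ℝ, |x ⬝ᵥ centredGram n (fun k => v k ω) *ᵥ y|
        ≤ t * √(96 * Real.log (Fintype.card ι) * R * n) * (√(x ⬝ᵥ x) * √(y ⬝ᵥ y))}
      ≤ ENNReal.ofReal (3 / t ^ 2) := by
  obtain ⟨r, hr1, hr2⟩ := exists_nat_log_le hp
  set p := Fintype.card ι
  have hlog : 0 ≤ Real.log p := Real.log_natCast_nonneg p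
  have hn' : 8 * (r + 1 : ℕ) * R ≤ n := by
    refine le_trans ?_ hn
    have := mul_le_mul_of_nonneg_right hr2 hR0
    linarith
  have hn0 : 0 ≤ n := le_trans (by positivity) hn'
  have hA : 32 * (r + 1 : ℕ) * R * n ≤ 96 * Real.log p * R * n := by
    have := mul_le_mul_of_nonneg_right (mul_le_mul_of_nonneg_right hr2 hR0) hn0
    linarith
  set A := 96 * Real.log p * R * n with hAd
  have hA0 : 0 ≤ A := by positivity
  have hmom : ∫ ω, (centredGram n (fun k => v k ω) ^ (2 * (r + 1))).trace ∂μ ≤ p * A ^ (r + 1) := by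
    refine (integral_trace_centredGram_pow_le hv hR0 hR hind hC r hn').trans ?_
    gcongr
  have hint : Integrable (fun ω => (centredGram n (fun k => v k ω) ^ (2 * (r + 1))).trace) μ :=
    integrable_of_continuous_of_dotProduct_le hv hR
      (F := fun x => (centredGram n x ^ (2 * (r + 1))).trace)
      (by have := continuous_centredGram (ι := ι) (κ := κ) n; fun_prop)
  have hp0 : (0 : ℝ) < p := by
    have : 0 < p := by omega
    exact_mod_cast this
  have ht0 : 0 < t := by linarith
  -- This `s` cancels the dimension in the moment bound, leaving the threshold `(t√A)^(2(r+1))`.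
  have hmk := measure_mul_lt_le (s := (t ^ 2) ^ (r + 1) / p)
    (fun ω => trace_pow_even_nonneg (isSymm_centredGram n (fun k => v k ω)) (r + 1)) hint hmom
    (by positivity)
  have hprod : (t ^ 2) ^ (r + 1) / p * (p * A ^ (r + 1)) = (t * √A) ^ (2 * (r + 1)) := by
    rw [pow_mul (t * √A), mul_pow t, Real.sq_sqrt hA0, mul_pow (t ^ 2)]
    field_simp
  rw [hprod] at hmk
  refine (measure_mono ?_).trans (hmk.trans (ENNReal.ofReal_le_ofReal ?_))
  · intro ω hω
    by_contra hcon
    rw [Set.mem_ofPred_eq, not_lt] at hcon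
    exact hω fun x y => abs_bilin_le_of_trace_pow_le (isSymm_centredGram _ _) (Nat.succ_ne_zero r)
      (by positivity) hcon x y
  -- The failure probability is `p / t^(2(r+1)) ≤ (e / t²)^(r+1)`. Since `e ≤ 3 ≤ t²`, the power may
  -- be dropped.
  · rw [one_div_div]
    have he : Real.exp 1 ≤ 3 := by linarith [Real.exp_one_lt_d9]
    have h3 : 3 / t ^ 2 ≤ 1 := by
      rw [div_le_one (by positivity)]
      nlinarith
    calc (p : ℝ) / (t ^ 2) ^ (r + 1) ≤ 3 ^ (r + 1) / (t ^ 2) ^ (r + 1) := by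
          gcongr
          exact hr1.trans (pow_le_pow_left₀ (Real.exp_pos 1).le he _)
      _ = (3 / t ^ 2) ^ (r + 1) := by rw [div_pow]
      _ ≤ (3 / t ^ 2) ^ 1 := pow_le_pow_of_le_one (by positivity) h3 (by omega)
      _ = _ := pow_one _

end Moment

/-! ### Moments from the Orlicz norm -/

section SubGaussian

variable {Ω : Type*} [MeasurableSpace Ω] {μ : Measure Ω} {Z : Ω → ℝ}

theorem integral_le_of_lintegral_ofReal_le {f : Ω → ℝ} (hf : Measurable f) (hf0 : ∀ ω, 0 ≤ f ω)
    {c : ℝ} (hc : 0 ≤ c) (h : ∫⁻ ω, ENNReal.ofReal (f ω) ∂μ ≤ ENNReal.ofReal c) :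
    Integrable f μ ∧ ∫ ω, f ω ∂μ ≤ c := by
  refine ⟨⟨hf.aestronglyMeasurable, ?_⟩, ?_⟩
  · rw [hasFiniteIntegral_iff_ofReal (Eventually.of_forall hf0)]
    exact h.trans_lt ENNReal.ofReal_lt_top
  · rw [integral_eq_lintegral_of_nonneg_ae (Eventually.of_forall hf0) hf.aestronglyMeasurable]
    exact ENNReal.toReal_le_of_le_ofReal hc h

/-- Both bounds come from `exp z - 1 ≥ z + z²/2` at `z = (Z/L)²`, keeping one term at a time. -/
theorem moments_le_of_lintegral_exp_lt (hZ : Measurable Z) {L : ℝ} (hL : 0 < L)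
    (h : ∫⁻ ω, ENNReal.ofReal (Real.exp (|Z ω / L| ^ 2) - 1) ∂μ < 1) :
    (Integrable (fun ω => Z ω ^ 2) μ ∧ ∫ ω, Z ω ^ 2 ∂μ ≤ L ^ 2) ∧
    (Integrable (fun ω => Z ω ^ 4) μ ∧ ∫ ω, Z ω ^ 4 ∂μ ≤ 2 * L ^ 4) := by
  have hexp : ∀ ω, (Z ω / L) ^ 2 + ((Z ω / L) ^ 2) ^ 2 / 2 ≤ Real.exp (|Z ω / L| ^ 2) - 1 := by
    intro ω
    have := Real.quadratic_le_exp_of_nonneg (x := (Z ω / L) ^ 2) (sq_nonneg _)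
    rw [sq_abs]
    linarith
  have aux : ∀ {f : Ω → ℝ} {c : ℝ}, Measurable f → (∀ ω, 0 ≤ f ω) → 0 < c →
      (∀ ω, f ω ≤ c * (Real.exp (|Z ω / L| ^ 2) - 1)) → Integrable f μ ∧ ∫ ω, f ω ∂μ ≤ c := by
    intro f c hf hf0 hc hle
    refine integral_le_of_lintegral_ofReal_le hf hf0 hc.le ?_
    calc ∫⁻ ω, ENNReal.ofReal (f ω) ∂μ
        ≤ ∫⁻ ω, ENNReal.ofReal c * ENNReal.ofReal (Real.exp (|Z ω / L| ^ 2) - 1) ∂μ := by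
          refine lintegral_mono fun ω => ?_
          rw [← ENNReal.ofReal_mul hc.le]
          exact ENNReal.ofReal_le_ofReal (hle ω)
      _ = ENNReal.ofReal c * ∫⁻ ω, ENNReal.ofReal (Real.exp (|Z ω / L| ^ 2) - 1) ∂μ :=
          lintegral_const_mul' _ _ ENNReal.ofReal_ne_top
      _ ≤ ENNReal.ofReal c * 1 := by gcongr
      _ = _ := mul_one _
  refine ⟨aux (by fun_prop) (fun ω => sq_nonneg _) (by positivity) fun ω => ?_,
    aux (by fun_prop) (fun ω => by positivity) (by positivity) fun ω => ?_⟩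
  · calc Z ω ^ 2 = L ^ 2 * (Z ω / L) ^ 2 := by field_simp
      _ ≤ _ := by
        refine mul_le_mul_of_nonneg_left ?_ (by positivity)
        have := hexp ω
        have := sq_nonneg ((Z ω / L) ^ 2)
        linarith
  · calc Z ω ^ 4 = 2 * L ^ 4 * (((Z ω / L) ^ 2) ^ 2 / 2) := by field_simp
      _ ≤ _ := by
        refine mul_le_mul_of_nonneg_left ?_ (by positivity)
        have := hexp ω
        have := sq_nonneg (Z ω / L)
        linarith

/-- Second and fourth moments of a sub-Gaussian variable. -/
theorem moments_le_of_psiTwoNorm_le (hZ : Measurable Z) {K : ℝ≥0} (h : psiTwoNorm μ Z ≤ K) :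
    (Integrable (fun ω => Z ω ^ 2) μ ∧ ∫ ω, Z ω ^ 2 ∂μ ≤ (K : ℝ) ^ 2) ∧
    (Integrable (fun ω => Z ω ^ 4) μ ∧ ∫ ω, Z ω ^ 4 ∂μ ≤ 2 * (K : ℝ) ^ 4) := by
  have hex : ∀ K' : ℝ, (K : ℝ) < K' → ∃ L : ℝ, 0 < L ∧ L < K' ∧
      ∫⁻ ω, ENNReal.ofReal (Real.exp (|Z ω / L| ^ 2) - 1) ∂μ < 1 := by
    intro K' hK'
    have hlt : psiTwoNorm μ Z < ENNReal.ofReal K' := by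
      refine h.trans_lt ?_
      rw [← ENNReal.ofReal_coe_nnreal]
      exact (ENNReal.ofReal_lt_ofReal_iff (K.coe_nonneg.trans_lt hK')).2 hK'
    obtain ⟨a, ⟨L, hL, rfl, hLi⟩, ha⟩ := sInf_lt_iff.1 hlt
    exact ⟨L, hL, (ENNReal.ofReal_lt_ofReal_iff (K.coe_nonneg.trans_lt hK')).1 ha, hLi⟩
  -- The value `K` itself need not be admissible in the infimum and may be zero, so the bounds are
  -- proved for every `K' > K` and passed to the limit.
  have hlim : ∀ (f : ℝ → ℝ) (I : ℝ), Continuous f → (∀ K' : ℝ, (K : ℝ) < K' → I ≤ f K') →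
      I ≤ f K := by
    intro f I hf hI
    have ht : Tendsto f (𝓝[>] (K : ℝ)) (𝓝 (f K)) := (hf.tendsto _).mono_left nhdsWithin_le_nhds
    exact ge_of_tendsto ht (eventually_mem_nhdsWithin.mono fun K' hK' => hI K' hK')
  obtain ⟨L, hL, -, hLi⟩ := hex (K + 1) (by linarith)
  have h0 := moments_le_of_lintegral_exp_lt hZ hL hLi
  refine ⟨⟨h0.1.1, hlim (fun x => x ^ 2) _ (by fun_prop) fun K' hK' => ?_⟩,
    ⟨h0.2.1, hlim (fun x => 2 * x ^ 4) _ (by fun_prop) fun K' hK' => ?_⟩⟩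
  · obtain ⟨L, hL, hLK, hLi⟩ := hex K' hK'
    refine (moments_le_of_lintegral_exp_lt hZ hL hLi).1.2.trans ?_
    gcongr
  · obtain ⟨L, hL, hLK, hLi⟩ := hex K' hK'
    refine (moments_le_of_lintegral_exp_lt hZ hL hLi).2.2.trans ?_
    gcongr

end SubGaussian

/-! ### Variance bounds for independent sums and the noise vector -/

section Fluctuation

variable {ι κ Ω : Type*} [Fintype ι] [Fintype κ]
  [MeasurableSpace Ω] {μ : Measure Ω}

theorem memLp_mul_coord {v : Ω → ι → ℝ} (hv : Measurable v) {R : ℝ}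
    (hR : ∀ᵐ ω ∂μ, v ω ⬝ᵥ v ω ≤ R) {Y : Ω → ℝ} (hY : MemLp Y 2 μ) (j : ι) :
    MemLp (fun ω => Y ω * v ω j) 2 μ := by
  have hm : Measurable fun ω => v ω j := by fun_prop
  refine MemLp.of_le_mul (c := √R) hY (hY.aestronglyMeasurable.mul hm.aestronglyMeasurable) ?_
  filter_upwards [hR] with ω hω
  rw [norm_mul, mul_comm]
  exact mul_le_mul_of_nonneg_right ((norm_le_pi_norm _ j).trans (norm_le_sqrt_of_dotProduct_le hω))
    (norm_nonneg _)

variable [IsProbabilityMeasure μ]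

theorem integrable_sq_sum_sub {W : κ → Ω → ℝ} (hW : ∀ i, MemLp (W i) 2 μ) (c : ℝ) :
    Integrable (fun ω => (∑ i, W i ω - c) ^ 2) μ := by
  have : MemLp (fun ω => ∑ i, W i ω - c) 2 μ :=
    (memLp_finsetSum _ fun i _ => hW i).sub (memLp_const c)
  exact this.integrable_sq

theorem integral_sq_sum_sub_le {W : κ → Ω → ℝ} (hW : ∀ i, MemLp (W i) 2 μ) (hind : iIndepFun W μ) :
    ∫ ω, (∑ i, W i ω - ∑ i, ∫ ω', W i ω' ∂μ) ^ 2 ∂μ ≤ ∑ i, ∫ ω, W i ω ^ 2 ∂μ := by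
  have hs : MemLp (∑ i, W i) 2 μ := memLp_finsetSum' _ fun i _ => hW i
  have h1 : variance (∑ i, W i) μ = ∫ ω, (∑ i, W i ω - ∑ i, ∫ ω', W i ω' ∂μ) ^ 2 ∂μ := by
    rw [variance_eq_integral hs.aemeasurable]
    simp only [Finset.sum_apply]
    rw [integral_finsetSum _ fun i _ => (hW i).integrable (by norm_num)]
  rw [← h1, IndepFun.variance_sum (fun i _ => hW i) fun i _ j _ hij => hind.indepFun hij]
  refine Finset.sum_le_sum fun i _ => ?_
  rw [variance_eq_sub (hW i)]
  have : μ[W i ^ 2] = ∫ ω, W i ω ^ 2 ∂μ := rfl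
  rw [this]
  linarith [sq_nonneg (μ[W i])]

/-- The vector `∑ i, (Yᵢ vᵢ - E Yᵢ vᵢ)`. -/
def noise (μ : Measure Ω) (v : κ → Ω → ι → ℝ) (Y : κ → Ω → ℝ) (ω : Ω) : ι → ℝ :=
  fun j => ∑ i, Y i ω * v i ω j - ∑ i, ∫ ω', Y i ω' * v i ω' j ∂μ

/-- Variances add over `i` in each coordinate, and summing over coordinates recombines them into `E
|vᵢ|² Yᵢ² ≤ R E Yᵢ²`. The dimension thus enters only through `R`. -/
theorem noise_sq_integrable_and_le {v : κ → Ω → ι → ℝ} (hv : ∀ i, Measurable (v i)) {R : ℝ}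
    (hR0 : 0 ≤ R) (hR : ∀ i, ∀ᵐ ω ∂μ, v i ω ⬝ᵥ v i ω ≤ R) {Y : κ → Ω → ℝ}
    (hY : ∀ i, MemLp (Y i) 2 μ) (hind : iIndepFun (fun i ω => (v i ω, Y i ω)) μ) {K : ℝ}
    (hK : ∀ i, ∫ ω, Y i ω ^ 2 ∂μ ≤ K ^ 2) :
    Integrable (fun ω => noise μ v Y ω ⬝ᵥ noise μ v Y ω) μ ∧
    ∫ ω, noise μ v Y ω ⬝ᵥ noise μ v Y ω ∂μ ≤ Fintype.card κ * (R * K ^ 2) := by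
  have hL : ∀ i j, MemLp (fun ω => Y i ω * v i ω j) 2 μ := fun i j =>
    memLp_mul_coord (hv i) (hR i) (hY i) j
  have hi : ∀ j, Integrable (fun ω => noise μ v Y ω j * noise μ v Y ω j) μ := by
    intro j
    simp only [← pow_two]
    exact integrable_sq_sum_sub (fun i => hL i j) _
  have hbd : ∀ j, ∫ ω, noise μ v Y ω j * noise μ v Y ω j ∂μ
      ≤ ∑ i, ∫ ω, (Y i ω * v i ω j) ^ 2 ∂μ := by
    intro j
    simp only [← pow_two]
    refine integral_sq_sum_sub_le (fun i => hL i j) ?_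
    exact hind.comp (fun _ z => z.2 * z.1 j) fun _ => by fun_prop
  refine ⟨integrable_finsetSum _ fun j _ => hi j, ?_⟩
  calc ∫ ω, noise μ v Y ω ⬝ᵥ noise μ v Y ω ∂μ
      = ∑ j, ∫ ω, noise μ v Y ω j * noise μ v Y ω j ∂μ := by
        simp only [dotProduct]
        rw [integral_finsetSum _ fun j _ => hi j]
    _ ≤ ∑ j, ∑ i, ∫ ω, (Y i ω * v i ω j) ^ 2 ∂μ := Finset.sum_le_sum fun j _ => hbd j
    _ = ∑ i, ∫ ω, ∑ j, (Y i ω * v i ω j) ^ 2 ∂μ := by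
        rw [Finset.sum_comm]
        refine Finset.sum_congr rfl fun i _ => ?_
        rw [integral_finsetSum _ fun j _ => (hL i j).integrable_sq]
    _ ≤ ∑ i : κ, R * K ^ 2 := by
        refine Finset.sum_le_sum fun i _ => ?_
        calc ∫ ω, ∑ j, (Y i ω * v i ω j) ^ 2 ∂μ ≤ ∫ ω, R * Y i ω ^ 2 ∂μ := by
              refine integral_mono_ae (integrable_finsetSum _ fun j _ => (hL i j).integrable_sq)
                ((hY i).integrable_sq.const_mul R) ?_
              filter_upwards [hR i] with ω hω
              have : ∑ j, (Y i ω * v i ω j) ^ 2 = (v i ω ⬝ᵥ v i ω) * Y i ω ^ 2 := by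
                rw [dotProduct, Finset.sum_mul]
                exact Finset.sum_congr rfl fun j _ => by ring
              rw [this]
              exact mul_le_mul_of_nonneg_right hω (sq_nonneg _)
          _ ≤ R * K ^ 2 := by
              rw [integral_const_mul]
              exact mul_le_mul_of_nonneg_left (hK i) hR0
    _ = _ := by simp

end Fluctuation

/-! ### Orthonormalizing the dictionary -/

section Whitening

theorem dotProduct_mulVec_eq_sum {ι : Type*} [Fintype ι] (x y : ι → ℝ) (A : Matrix ι ι ℝ) :
    x ⬝ᵥ A *ᵥ y = ∑ j, ∑ k, x j * y k * A j k := by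
  simp only [dotProduct, mulVec, Finset.mul_sum]
  exact Finset.sum_congr rfl fun j _ => Finset.sum_congr rfl fun k _ => by ring

/-- A symmetric matrix is bounded below by the infimum of its spectrum, and is a square. -/
theorem exists_transpose_mul_self_of_sInf_spectrum_pos {ι : Type*} [Fintype ι] [DecidableEq ι]
    {A : Matrix ι ι ℝ} (hA : A.IsSymm) (hpos : 0 < sInf (spectrum ℝ A)) :
    (∀ x : ι → ℝ, sInf (spectrum ℝ A) * (x ⬝ᵥ x) ≤ x ⬝ᵥ A *ᵥ x) ∧
      ∃ B : Matrix ι ι ℝ, IsUnit B.det ∧ A = Bᵀ * B := by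
  obtain ⟨U, d, h1, -, hmem, hpow⟩ := exists_orthogonal_diagonalization hA
  set l := sInf (spectrum ℝ A)
  have hd : ∀ i, l ≤ d i := fun i => csInf_le A.finite_real_spectrum.bddBelow (hmem i)
  have h3 : A = U * diagonal d * Uᵀ := by simpa using hpow 1
  clear_value l
  constructor
  · intro x
    have hx : x ⬝ᵥ x = (Uᵀ *ᵥ x) ⬝ᵥ (Uᵀ *ᵥ x) := by
      rw [dotProduct_mulVec, vecMul_transpose, mulVec_mulVec, h1, one_mulVec]
    rw [hx, h3, ← mulVec_mulVec, ← mulVec_mulVec, dotProduct_mulVec x, ← mulVec_transpose]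
    simp only [dotProduct, mulVec_diagonal, Finset.mul_sum]
    refine Finset.sum_le_sum fun i _ => ?_
    have := mul_le_mul_of_nonneg_right (hd i) (mul_self_nonneg ((Uᵀ *ᵥ x) i))
    linarith
  · refine ⟨diagonal (fun i => √(d i)) * Uᵀ, ?_, ?_⟩
    · rw [det_mul, det_diagonal, det_transpose]
      refine IsUnit.mul ?_ ?_
      · rw [isUnit_iff_ne_zero]
        exact Finset.prod_ne_zero_iff.2 fun i _ =>
          (Real.sqrt_pos.2 (hpos.trans_le (hd i))).ne'
      · have := congrArg det h1
        rw [det_mul, det_one] at this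
        exact IsUnit.of_mul_eq_one _ this
    · rw [transpose_mul, transpose_transpose, diagonal_transpose, Matrix.mul_assoc,
        ← Matrix.mul_assoc (diagonal _) (diagonal _), diagonal_mul_diagonal, ← Matrix.mul_assoc]
      rw [h3]
      congr 3
      ext i
      rw [Real.mul_self_sqrt (hpos.trans_le (hd i)).le]

variable {Ω 𝒳 : Type*} [MeasurableSpace Ω] [MeasurableSpace 𝒳] {n p : ℕ}
  {μ : Measure Ω}

theorem secondMoment_map_apply {ι : Type*} {v : Ω → ι → ℝ} (hv : Measurable v) (j k : ι) :
    secondMoment (μ.map v) j k = ∫ ω, v ω j * v ω k ∂μ := by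
  have hm : Measurable fun u : ι → ℝ => u j * u k :=
    (measurable_pi_apply j).mul (measurable_pi_apply k)
  rw [secondMoment, Matrix.of_apply, integral_map hv.aemeasurable hm.aestronglyMeasurable]

variable [IsProbabilityMeasure μ]

/-- An orthonormal dictionary spanning the same functions: `f_β = (B β) ⬝ᵥ φ`. -/
theorem exists_whitening {X : Fin n → Ω → 𝒳} {ψ : Fin p → 𝒳 → ℝ} (hX : ∀ i, Measurable (X i))
    (hψ : ∀ j, Measurable (ψ j)) {KX : ℝ} (hKX : ∀ i j, ∀ᵐ ω ∂μ, |ψ j (X i ω)| ≤ KX) (hn : 1 ≤ n)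
    (hΛ : 0 < lambdaMin μ X ψ) :
    ∃ (B : Matrix (Fin p) (Fin p) ℝ) (φ : 𝒳 → Fin p → ℝ), Measurable φ ∧
      (∀ β x, linFun ψ β x = (B *ᵥ β) ⬝ᵥ φ x) ∧
      (∀ i, ∀ᵐ ω ∂μ, φ (X i ω) ⬝ᵥ φ (X i ω) ≤ p * KX ^ 2 / lambdaMin μ X ψ ^ 2) ∧
      ∑ i, secondMoment (μ.map (fun ω => φ (X i ω))) = (n : ℝ) • 1 := by
  set G := gramMatrix μ X ψ with hG
  have hsym : G.IsSymm := by
    ext j k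
    simp only [hG, gramMatrix, Matrix.of_apply, Matrix.transpose_apply]
    simp only [mul_comm]
  have hn0 : (n : ℝ) ≠ 0 := by
    have : n ≠ 0 := by omega
    exact_mod_cast this
  have hspos : 0 < sInf (spectrum ℝ G) := Real.sqrt_pos.1 hΛ
  have hΛ2 : lambdaMin μ X ψ ^ 2 = sInf (spectrum ℝ G) := Real.sq_sqrt hspos.le
  obtain ⟨hlow, B, hB, hGB⟩ := exists_transpose_mul_self_of_sInf_spectrum_pos hsym hspos
  -- Coefficients are transformed by `B`, so the dictionary must be transformed by the inverse
  -- transpose for the pairing to be preserved.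
  set W := (B⁻¹)ᵀ with hW
  have hBW : Bᵀ * W = 1 := by rw [hW, ← transpose_mul, nonsing_inv_mul _ hB, transpose_one]
  have hWB : W * Bᵀ = 1 := by rw [hW, ← transpose_mul, mul_nonsing_inv _ hB, transpose_one]
  have hWGW : W * G * Wᵀ = 1 := by
    have h2 : B * Wᵀ = 1 := by rw [← transpose_transpose B, ← transpose_mul, hWB, transpose_one]
    rw [hGB, ← Matrix.mul_assoc, hWB, Matrix.one_mul, h2]
  set Ψ : 𝒳 → Fin p → ℝ := fun x j => ψ j x with hΨ
  have hΨm : Measurable Ψ := measurable_pi_lambda _ hψ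
  have hφm : Measurable fun x => W *ᵥ Ψ x :=
    (Continuous.matrix_mulVec continuous_const continuous_id).measurable.comp hΨm
  have hWm : ∀ i, Measurable fun ω => W *ᵥ Ψ (X i ω) := fun i => hφm.comp (hX i)
  have hΨXm : ∀ i, Measurable fun ω => Ψ (X i ω) := fun i => hΨm.comp (hX i)
  refine ⟨B, fun x => W *ᵥ Ψ x, hφm, fun β x => ?_, fun i => ?_, ?_⟩
  · have : (B *ᵥ β) ⬝ᵥ (W *ᵥ Ψ x) = β ⬝ᵥ Ψ x := by
      rw [dotProduct_comm, dotProduct_mulVec, ← mulVec_transpose, mulVec_mulVec, hBW, one_mulVec,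
        dotProduct_comm]
    rw [this]
    rfl
  · filter_upwards [ae_all_iff.2 (hKX i)] with ω hω
    have hψb : Ψ (X i ω) ⬝ᵥ Ψ (X i ω) ≤ p * KX ^ 2 := by
      calc Ψ (X i ω) ⬝ᵥ Ψ (X i ω) ≤ ∑ j : Fin p, KX ^ 2 := by
            refine Finset.sum_le_sum fun j _ => ?_
            have := sq_le_sq' (by linarith [neg_abs_le (ψ j (X i ω)), hω j])
              ((le_abs_self _).trans (hω j))
            rw [← pow_two]
            exact this
        _ = _ := by simp
    set z := Ψ (X i ω)
    -- Duality avoids the spectrum of the inverse Gram matrix. With `y = Wᵀx` one has `|x|² = y ⬝ z`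
    -- and `Λ²|y|² ≤ y ⬝ Gy = |x|²`, so Cauchy–Schwarz gives `Λ²|x|² ≤ |z|²`.
    set x := W *ᵥ z with hx
    set y := Wᵀ *ᵥ x with hy
    have hxx : x ⬝ᵥ x = y ⬝ᵥ z := by
      rw [hy, mulVec_transpose, ← dotProduct_mulVec]
    have hyy : y ⬝ᵥ G *ᵥ y = x ⬝ᵥ x := by
      rw [hy, mulVec_transpose, ← dotProduct_mulVec, ← mulVec_transpose, mulVec_mulVec,
        mulVec_mulVec, hWGW, one_mulVec]
    have hl := hlow y
    rw [hyy] at hl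
    rw [le_div_iff₀ (by positivity), hΛ2]
    have hcs : (y ⬝ᵥ z) ^ 2 ≤ (y ⬝ᵥ y) * (z ⬝ᵥ z) := by
      simp only [dotProduct, ← pow_two]
      exact Finset.sum_mul_sq_le_sq_mul_sq _ _ _
    rw [← hxx] at hcs
    have h0 := dotProduct_self_nonneg x
    have h1 := dotProduct_self_nonneg z
    rcases h0.eq_or_lt with h | h
    · rw [← h, zero_mul]; positivity
    · have h5 : (x ⬝ᵥ x) * (x ⬝ᵥ x * sInf (spectrum ℝ G)) ≤ (x ⬝ᵥ x) * (z ⬝ᵥ z) := by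
        have := mul_le_mul_of_nonneg_left hcs hspos.le
        have := mul_le_mul_of_nonneg_right hl h1
        nlinarith
      exact (le_of_mul_le_mul_left h5 h).trans hψb
  · have hint : ∀ i j k, Integrable (fun ω => Ψ (X i ω) j * Ψ (X i ω) k) μ := by
      intro i j k
      refine Integrable.of_bound (((hψ j).comp (hX i)).mul ((hψ k).comp (hX i))).aestronglyMeasurable
        (KX * KX) ?_
      filter_upwards [hKX i j, hKX i k] with ω h1 h2
      rw [norm_mul]
      exact mul_le_mul h1 h2 (abs_nonneg _) ((abs_nonneg _).trans h1)
    have hmom : ∀ i, secondMoment (μ.map (fun ω => W *ᵥ Ψ (X i ω)))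
        = W * secondMoment (μ.map (fun ω => Ψ (X i ω))) * Wᵀ := by
      intro i
      ext a b
      rw [secondMoment_map_apply (hWm i)]
      simp only [Matrix.mul_apply, Matrix.transpose_apply, secondMoment_map_apply (hΨXm i),
        mulVec, dotProduct, Finset.sum_mul_sum]
      rw [integral_finsetSum]
      · rw [Finset.sum_congr rfl fun k _ => Finset.sum_mul _ _ _]
        rw [Finset.sum_comm]
        refine Finset.sum_congr rfl fun j _ => ?_
        rw [integral_finsetSum]
        · refine Finset.sum_congr rfl fun k _ => ?_
          rw [mul_right_comm, ← integral_const_mul]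
          refine integral_congr_ae (Eventually.of_forall fun ω => ?_)
          simp only
          ring
        · intro k _
          have := (hint i j k).const_mul (W a j * W b k)
          refine this.congr (Eventually.of_forall fun ω => ?_)
          simp only
          ring
      · intro j _
        refine integrable_finsetSum _ fun k _ => ?_
        have := (hint i j k).const_mul (W a j * W b k)
        refine this.congr (Eventually.of_forall fun ω => ?_)
        simp only
        ring
    have hsum : ∑ i, secondMoment (μ.map (fun ω => Ψ (X i ω))) = (n : ℝ) • G := by
      ext j k
      rw [Matrix.sum_apply, Matrix.smul_apply, hG, gramMatrix, Matrix.of_apply, smul_eq_mul,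
        mul_div_cancel₀ _ hn0]
      exact Finset.sum_congr rfl fun i _ => secondMoment_map_apply (hΨXm i) j k
    simp only [hmom]
    rw [← Finset.sum_mul, ← Finset.mul_sum, hsum, mul_smul_comm, smul_mul_assoc, hWGW]

end Whitening

/-! ### Deterministic comparison of the estimator and the projection -/

section Core

/-- The quadratic criterion for a minimizer along a line. -/
theorem eq_zero_of_forall_quadratic_nonneg {a b : ℝ} (h : ∀ t : ℝ, 0 ≤ t ^ 2 * b - 2 * t * a) :
    a = 0 := by
  by_contra ha
  have hb : 0 ≤ b ∨ b < 0 := le_or_gt 0 b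
  rcases hb with hb | hb
  · have := h (a / (b + 1))
    have h1 : (a / (b + 1)) ^ 2 * b - 2 * (a / (b + 1)) * a = - (a ^ 2 * (b + 2)) / (b + 1) ^ 2 := by
      field_simp
      ring
    rw [h1] at this
    have h2 : 0 < a ^ 2 * (b + 2) / (b + 1) ^ 2 := by positivity
    rw [neg_div] at this
    linarith
  · have h1 := h 1
    have h2 := h (-1)
    nlinarith

theorem abs_dotProduct_le {ι : Type*} [Fintype ι] (x y : ι → ℝ) : |x ⬝ᵥ y| ≤ √(x ⬝ᵥ x) * √(y ⬝ᵥ y) := by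
  rw [← Real.sqrt_mul (dotProduct_self_nonneg x)]
  refine Real.abs_le_sqrt ?_
  simp only [dotProduct, ← pow_two]
  exact Finset.sum_mul_sq_le_sq_mul_sq _ _ _

variable {ι κ : Type*} [Fintype ι] [DecidableEq ι] [Fintype κ]

theorem sum_dotProduct_mul_dotProduct (c : ℝ) (v : κ → ι → ℝ) (x y : ι → ℝ) :
    ∑ i, (x ⬝ᵥ v i) * (y ⬝ᵥ v i) = x ⬝ᵥ centredGram c v *ᵥ y + c * (x ⬝ᵥ y) := by
  rw [centredGram, sub_mulVec, dotProduct_sub, smul_mulVec, one_mulVec, dotProduct_smul,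
    smul_eq_mul, sub_add_cancel, sum_mulVec, dotProduct_sum]
  refine Finset.sum_congr rfl fun i _ => ?_
  rw [vecMulVec_mulVec, op_smul_eq_smul, dotProduct_smul, smul_eq_mul, dotProduct_comm y]
  ring

/-- The deterministic comparison of least squares with its population version, in orthonormal
coordinates. Here `m = E ∑ i, Yᵢ vᵢ`, and `a`, `b` are the coordinates of the estimator and of its
population version. -/
theorem leastSquares_comparison {n τ s : ℝ} (hn : 0 < n) {v : κ → ι → ℝ} {Y : κ → ℝ}
    (hτ2 : τ ≤ 1 / 2)
    (hτ : ∀ x y : ι → ℝ, |x ⬝ᵥ centredGram n v *ᵥ y| ≤ n * τ * (√(x ⬝ᵥ x) * √(y ⬝ᵥ y)))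
    {ξ m : ι → ℝ} (hξ : ∀ j, ξ j = ∑ i, Y i * v i j - m j) (hs : √(ξ ⬝ᵥ ξ) ≤ n * s)
    {a b : ι → ℝ} (ha : ∑ i, (Y i - a ⬝ᵥ v i) * ((a - b) ⬝ᵥ v i) = 0)
    (hb : (a - b) ⬝ᵥ m = n * ((a - b) ⬝ᵥ b)) (hbb : b ⬝ᵥ m = n * (b ⬝ᵥ b)) :
    √((a - b) ⬝ᵥ (a - b)) ≤ 2 * (s + τ * √(b ⬝ᵥ b)) ∧
    ∀ m₂ : ℝ, |∑ i, (Y i - a ⬝ᵥ v i) ^ 2 - (m₂ - n * (b ⬝ᵥ b))|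
      ≤ |∑ i, Y i ^ 2 - m₂| + n * (2 * s * √(b ⬝ᵥ b) + τ * √(b ⬝ᵥ b) ^ 2
        + (s + τ * √(b ⬝ᵥ b)) * √((a - b) ⬝ᵥ (a - b))) := by
  have hYx : ∀ x : ι → ℝ, ∑ i, Y i * (x ⬝ᵥ v i) = x ⬝ᵥ ξ + x ⬝ᵥ m := by
    intro x
    rw [← dotProduct_add]
    simp only [dotProduct, Pi.add_apply, hξ, sub_add_cancel, Finset.mul_sum]
    rw [Finset.sum_comm]
    exact Finset.sum_congr rfl fun j _ => Finset.sum_congr rfl fun i _ => by ring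
  set g := a - b with hg
  have hag : ∀ i, a ⬝ᵥ v i = g ⬝ᵥ v i + b ⬝ᵥ v i := fun i => by
    rw [← add_dotProduct, hg, sub_add_cancel]
  have hgg := sum_dotProduct_mul_dotProduct n v g g
  have hgb := sum_dotProduct_mul_dotProduct n v g b
  have hb2 := sum_dotProduct_mul_dotProduct n v b b
  -- The empirical normal equation in direction `g`; its population counterpart `hb` cancels the
  -- terms of order `n`, leaving only fluctuations.
  have hmain : ∑ i, (g ⬝ᵥ v i) * (g ⬝ᵥ v i) = g ⬝ᵥ ξ - g ⬝ᵥ centredGram n v *ᵥ b := by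
    have h1 : ∑ i, (Y i - a ⬝ᵥ v i) * (g ⬝ᵥ v i) = ∑ i, Y i * (g ⬝ᵥ v i)
        - ∑ i, (g ⬝ᵥ v i) * (g ⬝ᵥ v i) - ∑ i, (g ⬝ᵥ v i) * (b ⬝ᵥ v i) := by
      rw [← Finset.sum_sub_distrib, ← Finset.sum_sub_distrib]
      exact Finset.sum_congr rfl fun i _ => by rw [hag]; ring
    rw [ha, hYx, hb, hgb] at h1
    linarith
  have hnng : 0 ≤ ∑ i, (g ⬝ᵥ v i) * (g ⬝ᵥ v i) := Finset.sum_nonneg fun i _ => mul_self_nonneg _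
  have hG0 := Real.sqrt_nonneg (g ⬝ᵥ g)
  have hB0 := Real.sqrt_nonneg (b ⬝ᵥ b)
  have hGsq : g ⬝ᵥ g = √(g ⬝ᵥ g) ^ 2 := (Real.sq_sqrt (dotProduct_self_nonneg g)).symm
  have hBsq : b ⬝ᵥ b = √(b ⬝ᵥ b) ^ 2 := (Real.sq_sqrt (dotProduct_self_nonneg b)).symm
  have b1 := (abs_le.1 (abs_dotProduct_le g ξ)).2
  have b2 := (abs_le.1 (hτ g b)).1
  have b3 := (abs_le.1 (hτ g g)).1
  have b4 := abs_dotProduct_le b ξ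
  have b5 := hτ b b
  set Gn := √(g ⬝ᵥ g)
  set Bn := √(b ⬝ᵥ b)
  have b1' : g ⬝ᵥ ξ ≤ Gn * (n * s) := b1.trans (mul_le_mul_of_nonneg_left hs hG0)
  have b4' : |b ⬝ᵥ ξ| ≤ Bn * (n * s) := b4.trans (mul_le_mul_of_nonneg_left hs hB0)
  have hup : ∑ i, (g ⬝ᵥ v i) * (g ⬝ᵥ v i) ≤ n * ((s + τ * Bn) * Gn) := by
    rw [hmain]
    linarith
  have hlo : n * (Gn ^ 2 / 2) ≤ ∑ i, (g ⬝ᵥ v i) * (g ⬝ᵥ v i) := by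
    rw [hgg, hGsq]
    have : n * (τ * Gn ^ 2) ≤ n * (1 / 2 * Gn ^ 2) :=
      mul_le_mul_of_nonneg_left (mul_le_mul_of_nonneg_right hτ2 (sq_nonneg _)) hn.le
    linarith
  refine ⟨?_, fun m₂ => ?_⟩
  · have h6 : Gn ^ 2 / 2 ≤ (s + τ * Bn) * Gn := le_of_mul_le_mul_left (hlo.trans hup) hn
    rcases hG0.eq_or_lt with h | h
    -- When `Gn = 0` only the sign of the bound is at issue: `s` bounds a norm, and so does `τ`
    -- unless `Bn = 0`.
    · have h7 : 0 ≤ n * s := (Real.sqrt_nonneg _).trans hs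
      have h8 : 0 ≤ s := nonneg_of_mul_nonneg_right h7 hn
      by_cases hBz : Bn = 0
      · rw [← h, hBz]; linarith
      · have hBp : 0 < Bn := lt_of_le_of_ne hB0 (Ne.symm hBz)
        have h9 : 0 ≤ n * τ * (Bn * Bn) := (abs_nonneg _).trans b5
        have h10 : 0 ≤ n * τ := nonneg_of_mul_nonneg_left h9 (mul_pos hBp hBp)
        have h11 : 0 ≤ τ := nonneg_of_mul_nonneg_right h10 hn
        rw [← h]
        positivity
    · have : Gn * (Gn / 2) ≤ Gn * (s + τ * Bn) := by linarith
      linarith [le_of_mul_le_mul_left this h]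
  -- Pythagoras: by the normal equation, the residual of `a` is that of `b` minus the empirical
  -- square of `g`.
  · have e : ∑ i, (Y i - a ⬝ᵥ v i) ^ 2 - (m₂ - n * (b ⬝ᵥ b))
        = (∑ i, Y i ^ 2 - m₂) - 2 * (b ⬝ᵥ ξ) + b ⬝ᵥ centredGram n v *ᵥ b
          - ∑ i, (g ⬝ᵥ v i) * (g ⬝ᵥ v i) := by
      have h1 : ∑ i, (Y i - a ⬝ᵥ v i) ^ 2 = ∑ i, Y i ^ 2 - 2 * ∑ i, Y i * (b ⬝ᵥ v i)
          + ∑ i, (b ⬝ᵥ v i) * (b ⬝ᵥ v i) - ∑ i, (g ⬝ᵥ v i) * (g ⬝ᵥ v i)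
          - 2 * ∑ i, (Y i - a ⬝ᵥ v i) * (g ⬝ᵥ v i) := by
        rw [Finset.mul_sum, Finset.mul_sum, ← Finset.sum_sub_distrib, ← Finset.sum_add_distrib,
          ← Finset.sum_sub_distrib, ← Finset.sum_sub_distrib]
        exact Finset.sum_congr rfl fun i _ => by rw [hag]; ring
      rw [h1, ha, hYx, hbb, hb2]
      ring
    rw [e]
    have c1 := abs_le.1 b4'
    have c2 := abs_le.1 b5
    have c3 := le_abs_self (∑ i, Y i ^ 2 - m₂)
    have c4 := neg_abs_le (∑ i, Y i ^ 2 - m₂)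
    have c5 := hnng.trans hup
    rw [abs_le]
    constructor <;> nlinarith

end Core

/-! ### Empirical and population normal equations -/

section NormalEquations

variable {Ω 𝒳 : Type*} {n p : ℕ}

theorem add_mul_mem_modelClass {ψ : Fin p → 𝒳 → ℝ} {S : Finset (Fin p)} {f g : 𝒳 → ℝ}
    (hf : f ∈ modelClass ψ S) (hg : g ∈ modelClass ψ S) (t : ℝ) :
    (fun x => f x + t * g x) ∈ modelClass ψ S := by
  obtain ⟨β, rfl⟩ := hf
  obtain ⟨β', rfl⟩ := hg
  refine ⟨fun j => β j + t * β' j, ?_⟩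
  funext x
  simp only [linFun, restrictTo, Finset.mul_sum, ← Finset.sum_add_distrib]
  refine Finset.sum_congr rfl fun j _ => ?_
  split_ifs <;> ring

theorem IsLeastSquares.normal_equation {X : Fin n → Ω → 𝒳} {Y : Fin n → Ω → ℝ}
    {ψ : Fin p → 𝒳 → ℝ} {S : Finset (Fin p)} {ω : Ω} {f : 𝒳 → ℝ}
    (hf : IsLeastSquares X Y (modelClass ψ S) ω f) {g : 𝒳 → ℝ} (hg : g ∈ modelClass ψ S) :
    ∑ i, (Y i ω - f (X i ω)) * g (X i ω) = 0 := by
  rcases Nat.eq_zero_or_pos n with rfl | hn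
  · simp
  have hn' : (0 : ℝ) < n := by exact_mod_cast hn
  refine eq_zero_of_forall_quadratic_nonneg (b := ∑ i, g (X i ω) ^ 2) fun t => ?_
  have h := hf.2 _ (add_mul_mem_modelClass hf.1 hg t)
  simp only [empNorm] at h
  rw [Real.sqrt_le_sqrt_iff (by positivity), div_le_div_iff_of_pos_right hn'] at h
  have e : ∑ i, (Y i ω - (f (X i ω) + t * g (X i ω))) ^ 2
      = ∑ i, (Y i ω - f (X i ω)) ^ 2 + (t ^ 2 * ∑ i, g (X i ω) ^ 2
        - 2 * t * ∑ i, (Y i ω - f (X i ω)) * g (X i ω)) := by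
    rw [Finset.mul_sum, Finset.mul_sum, ← Finset.sum_sub_distrib, ← Finset.sum_add_distrib]
    exact Finset.sum_congr rfl fun i _ => by ring
  rw [e] at h
  linarith

variable [MeasurableSpace Ω] [MeasurableSpace 𝒳] {μ : Measure Ω} [IsProbabilityMeasure μ]

/-- Since `g(Xᵢ)` is measurable for the conditioning field, it can be pulled into the conditional
expectation. This removes the regression from the population equations. -/
theorem integral_regression_mul {X : Fin n → Ω → 𝒳} {Y : Fin n → Ω → ℝ}
    (hX : ∀ i, Measurable (X i)) (hY : ∀ i, MemLp (Y i) 2 μ) {g : 𝒳 → ℝ} (hg : Measurable g)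
    (hgL : ∀ i, MemLp (fun ω => g (X i ω)) 2 μ) (i : Fin n) :
    ∫ ω, regression μ X Y i ω * g (X i ω) ∂μ = ∫ ω, Y i ω * g (X i ω) ∂μ := by
  have hm : MeasurableSpace.comap (X i) inferInstance ≤ (inferInstance : MeasurableSpace Ω) :=
    (hX i).comap_le
  have hgm : StronglyMeasurable[MeasurableSpace.comap (X i) inferInstance]
      (fun ω => g (X i ω)) :=
    (hg.comp (comap_measurable (X i))).stronglyMeasurable
  have hint : Integrable (Y i * fun ω => g (X i ω)) μ := (hY i).integrable_mul (hgL i)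
  have h := condExp_mul_of_stronglyMeasurable_right hgm hint ((hY i).integrable (by norm_num))
  exact (integral_congr_ae h.symm).trans (integral_condExp hm)

theorem IsProjection.normal_equation {X : Fin n → Ω → 𝒳} {Y : Fin n → Ω → ℝ}
    (hX : ∀ i, Measurable (X i)) (hY : ∀ i, MemLp (Y i) 2 μ) {ψ : Fin p → 𝒳 → ℝ}
    {S : Finset (Fin p)} {f g : 𝒳 → ℝ} (hf : IsProjection μ X Y (modelClass ψ S) f)
    (hfL : ∀ i, MemLp (fun ω => f (X i ω)) 2 μ) (hg : g ∈ modelClass ψ S) (hgm : Measurable g)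
    (hgL : ∀ i, MemLp (fun ω => g (X i ω)) 2 μ) :
    ∑ i, ∫ ω, Y i ω * g (X i ω) ∂μ = ∑ i, ∫ ω, f (X i ω) * g (X i ω) ∂μ := by
  rcases Nat.eq_zero_or_pos n with rfl | hn
  · simp
  have hn' : (0 : ℝ) < n := by exact_mod_cast hn
  have hreg : ∀ i, MemLp (regression μ X Y i) 2 μ := fun i =>
    (hY i).condExp (by norm_num)
  have hres : ∀ i, MemLp (fun ω => regression μ X Y i ω - f (X i ω)) 2 μ := fun i =>
    (hreg i).sub (hfL i)
  have hzero : ∑ i, ∫ ω, (regression μ X Y i ω - f (X i ω)) * g (X i ω) ∂μ = 0 := by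
    refine eq_zero_of_forall_quadratic_nonneg (b := ∑ i, ∫ ω, g (X i ω) ^ 2 ∂μ) fun t => ?_
    have h := hf.2 _ (add_mul_mem_modelClass hf.1 hg t)
    simp only [theoNorm] at h
    have hnn : 0 ≤ (∑ i, ∫ ω, (regression μ X Y i ω - (f (X i ω) + t * g (X i ω))) ^ 2 ∂μ) / n :=
      div_nonneg (Finset.sum_nonneg fun i _ => integral_nonneg fun ω => sq_nonneg _) hn'.le
    rw [Real.sqrt_le_sqrt_iff hnn, div_le_div_iff_of_pos_right hn'] at h
    have e : ∀ i, ∫ ω, (regression μ X Y i ω - (f (X i ω) + t * g (X i ω))) ^ 2 ∂μ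
        = ∫ ω, (regression μ X Y i ω - f (X i ω)) ^ 2 ∂μ + (t ^ 2 * ∫ ω, g (X i ω) ^ 2 ∂μ
          - 2 * t * ∫ ω, (regression μ X Y i ω - f (X i ω)) * g (X i ω) ∂μ) := by
      intro i
      have i1 := (hres i).integrable_sq
      have i2 := (hgL i).integrable_sq.const_mul (t ^ 2)
      have i3 : Integrable (fun ω => 2 * t *
          ((regression μ X Y i ω - f (X i ω)) * g (X i ω))) μ :=
        ((hres i).integrable_mul (hgL i)).const_mul (2 * t)
      have i4 : Integrable (fun ω => t ^ 2 * g (X i ω) ^ 2 - 2 * t *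
          ((regression μ X Y i ω - f (X i ω)) * g (X i ω))) μ := i2.sub i3
      rw [← integral_const_mul, ← integral_const_mul, ← integral_sub i2 i3,
        ← integral_add i1 i4]
      exact integral_congr_ae (Eventually.of_forall fun ω => by ring)
    simp only [e] at h
    rw [Finset.sum_add_distrib, Finset.sum_sub_distrib, ← Finset.mul_sum, ← Finset.mul_sum] at h
    linarith
  have hsplit : ∀ i, ∫ ω, (regression μ X Y i ω - f (X i ω)) * g (X i ω) ∂μ
      = ∫ ω, Y i ω * g (X i ω) ∂μ - ∫ ω, f (X i ω) * g (X i ω) ∂μ := by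
    intro i
    rw [← integral_regression_mul hX hY hgm hgL i]
    have i1 : Integrable (fun ω => regression μ X Y i ω * g (X i ω)) μ :=
      (hreg i).integrable_mul (hgL i)
    have i2 : Integrable (fun ω => f (X i ω) * g (X i ω)) μ := (hfL i).integrable_mul (hgL i)
    rw [← integral_sub i1 i2]
    exact integral_congr_ae (Eventually.of_forall fun ω => by ring)
  simp only [hsplit, Finset.sum_sub_distrib] at hzero
  linarith

end NormalEquations

/-! ### Consequences of orthonormal coordinates -/

section Orthonormal

variable {ι κ Ω : Type*} [Fintype ι] [MeasurableSpace Ω] {μ : Measure Ω}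
  [IsProbabilityMeasure μ]

theorem memLp_dotProduct {v : Ω → ι → ℝ} (hv : Measurable v) {R : ℝ}
    (hR : ∀ᵐ ω ∂μ, v ω ⬝ᵥ v ω ≤ R) (x : ι → ℝ) : MemLp (fun ω => x ⬝ᵥ v ω) 2 μ := by
  have hm : Measurable fun ω => x ⬝ᵥ v ω :=
    (by fun_prop : Continuous fun u : ι → ℝ => x ⬝ᵥ u).measurable.comp hv
  refine MemLp.of_bound hm.aestronglyMeasurable (√(x ⬝ᵥ x) * √R) ?_
  filter_upwards [hR] with ω hω
  exact (abs_dotProduct_le x (v ω)).trans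
    (mul_le_mul_of_nonneg_left (Real.sqrt_le_sqrt hω) (Real.sqrt_nonneg _))

theorem integral_dotProduct_mul_dotProduct {v : Ω → ι → ℝ} (hv : Measurable v) {R : ℝ}
    (hR : ∀ᵐ ω ∂μ, v ω ⬝ᵥ v ω ≤ R) (x y : ι → ℝ) :
    ∫ ω, (x ⬝ᵥ v ω) * (y ⬝ᵥ v ω) ∂μ = x ⬝ᵥ secondMoment (μ.map v) *ᵥ y := by
  have hb : ∀ᵐ ω ∂μ, ‖v ω‖ ≤ √R := hR.mono fun u hu => norm_le_sqrt_of_dotProduct_le hu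
  have hi : ∀ j k, Integrable (fun ω => x j * y k * (v ω j * v ω k)) μ := fun j k =>
    integrable_comp_of_continuous_of_bounded hv hb
      (F := fun u : ι → ℝ => x j * y k * (u j * u k)) (by fun_prop)
  have e : ∀ ω, (x ⬝ᵥ v ω) * (y ⬝ᵥ v ω) = ∑ j, ∑ k, x j * y k * (v ω j * v ω k) := by
    intro ω
    simp only [dotProduct, Finset.sum_mul_sum]
    exact Finset.sum_congr rfl fun j _ => Finset.sum_congr rfl fun k _ => by ring
  simp only [e]
  rw [dotProduct_mulVec_eq_sum, integral_finsetSum _ fun j _ => integrable_finsetSum _ fun k _ => hi j k]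
  refine Finset.sum_congr rfl fun j _ => ?_
  rw [integral_finsetSum _ fun k _ => hi j k]
  refine Finset.sum_congr rfl fun k _ => ?_
  rw [integral_const_mul, secondMoment_map_apply hv]

variable [DecidableEq ι] [Fintype κ]

theorem sum_integral_dotProduct_mul_dotProduct {v : κ → Ω → ι → ℝ} (hv : ∀ i, Measurable (v i))
    {R : ℝ} (hR : ∀ i, ∀ᵐ ω ∂μ, v i ω ⬝ᵥ v i ω ≤ R) {c : ℝ}
    (hC : ∑ i, secondMoment (μ.map (v i)) = c • (1 : Matrix ι ι ℝ)) (x y : ι → ℝ) :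
    ∑ i, ∫ ω, (x ⬝ᵥ v i ω) * (y ⬝ᵥ v i ω) ∂μ = c * (x ⬝ᵥ y) := by
  rw [Finset.sum_congr rfl fun i _ => integral_dotProduct_mul_dotProduct (hv i) (hR i) x y,
    ← dotProduct_sum, ← sum_mulVec, hC, smul_mulVec, one_mulVec, dotProduct_smul, smul_eq_mul]

/-- Take traces in the isotropy relation. The resulting `p ≤ R` makes `R log p` bounded below, so
the fluctuation of `∑ Yᵢ²`, of order `√n`, is also within the rate. -/
theorem card_le_of_secondMoment {v : κ → Ω → ι → ℝ} (hv : ∀ i, Measurable (v i))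
    {R : ℝ} (hR : ∀ i, ∀ᵐ ω ∂μ, v i ω ⬝ᵥ v i ω ≤ R) (hκ : 0 < Fintype.card κ)
    (hC : ∑ i, secondMoment (μ.map (v i)) = (Fintype.card κ : ℝ) • (1 : Matrix ι ι ℝ)) :
    (Fintype.card ι : ℝ) ≤ R := by
  have h1 := congrArg Matrix.trace hC
  rw [trace_smul, trace_one, smul_eq_mul, trace_sum] at h1
  have h2 : ∀ i, (secondMoment (μ.map (v i))).trace ≤ R := by
    intro i
    have hb : ∀ᵐ ω ∂μ, ‖v i ω‖ ≤ √R := (hR i).mono fun u hu => norm_le_sqrt_of_dotProduct_le hu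
    have hi : ∀ j, Integrable (fun ω => v i ω j * v i ω j) μ := fun j =>
      integrable_comp_of_continuous_of_bounded (hv i) hb
        (F := fun u : ι → ℝ => u j * u j) (by fun_prop)
    calc (secondMoment (μ.map (v i))).trace = ∫ ω, v i ω ⬝ᵥ v i ω ∂μ := by
          simp only [dotProduct]
          rw [integral_finsetSum _ fun j _ => hi j]
          exact Finset.sum_congr rfl fun j _ => secondMoment_map_apply (hv i) j j
      _ ≤ ∫ _, R ∂μ := integral_mono_ae (integrable_finsetSum _ fun j _ => hi j)
          (integrable_const _) (hR i)
      _ = R := by simp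
  have h3 : (Fintype.card κ : ℝ) * Fintype.card ι ≤ Fintype.card κ * R := by
    rw [← h1]
    refine (Finset.sum_le_sum fun i _ => h2 i).trans (le_of_eq ?_)
    simp
  exact le_of_mul_le_mul_left h3 (by exact_mod_cast hκ)

end Orthonormal

/-! ### Probability bounds at a fixed sample size -/

section FixedSample

theorem half_le_log {p : ℕ} (hp : 2 ≤ p) : 1 / 2 ≤ Real.log p := by
  have h2 : Real.log 2 ≤ Real.log p := Real.log_le_log (by norm_num) (by exact_mod_cast hp)
  linarith [Real.log_two_gt_d9]

variable {Ω 𝒳 : Type*} [MeasurableSpace Ω] [MeasurableSpace 𝒳] {n p : ℕ}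
  {μ : Measure Ω} [IsProbabilityMeasure μ]

/-- The three fluctuations that govern least squares are small with large probability. -/
theorem measure_fluctuations_le {v : Fin n → Ω → Fin p → ℝ} (hv : ∀ i, Measurable (v i)) {R : ℝ}
    (hR : ∀ i, ∀ᵐ ω ∂μ, v i ω ⬝ᵥ v i ω ≤ R)
    (hC : ∑ i, secondMoment (μ.map (v i)) = (n : ℝ) • (1 : Matrix (Fin p) (Fin p) ℝ))
    {Y : Fin n → Ω → ℝ} (hY : ∀ i, Measurable (Y i))
    (hind : iIndepFun (fun i ω => (v i ω, Y i ω)) μ) {K : ℝ≥0} (hK : UniformlySubGaussian μ Y K)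
    (hn : 1 ≤ n) (hp : 2 ≤ p) {ρ t : ℝ} (hρ0 : 0 ≤ ρ) (hρ : n * ρ ^ 2 = R * Real.log p)
    (ht : 2 ≤ t) (htρ : 20 * t * ρ ≤ 1) :
    μ {ω | ¬ ((∀ x y : Fin p → ℝ, |x ⬝ᵥ centredGram n (fun k => v k ω) *ᵥ y|
          ≤ n * (10 * t * ρ) * (√(x ⬝ᵥ x) * √(y ⬝ᵥ y))) ∧
        √(noise μ v Y ω ⬝ᵥ noise μ v Y ω) ≤ n * (2 * t * K * ρ) ∧
        |∑ i, Y i ω ^ 2 - ∑ i, ∫ ω', Y i ω' ^ 2 ∂μ| ≤ n * (2 * t * K ^ 2 * ρ))}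
      ≤ ENNReal.ofReal (5 / t ^ 2) := by
  have hn0 : (0 : ℝ) < n := by exact_mod_cast hn
  have hlog := half_le_log hp
  have hp2 : (2 : ℝ) ≤ p := by exact_mod_cast hp
  have hpR : (p : ℝ) ≤ R := by
    have := card_le_of_secondMoment hv hR (by simp; omega) (by simpa using hC)
    simpa using this
  have hR0 : 0 ≤ R := by linarith
  have ht0 : 0 < t := by linarith
  have hK0 := K.coe_nonneg
  have hRlog : 1 ≤ R * Real.log p := by nlinarith
  have hRle : R ≤ 2 * (n * ρ ^ 2) := by rw [hρ]; nlinarith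
  have hmom := fun i => moments_le_of_psiTwoNorm_le (hY i) (hK i)
  have hY2 : ∀ i, MemLp (Y i) 2 μ := fun i =>
    (memLp_two_iff_integrable_sq (hY i).aestronglyMeasurable).2 (hmom i).1.1
  -- the Gram matrix
  have hE1 := measure_centredGram_bilin_le hv hR0 hR
    (hind.comp (fun _ z => z.1) fun _ => measurable_fst) hC (by simpa using hp)
    (by
      have h1 : t * ρ ≤ 1 / 20 := by linarith
      have h2 : 2 * ρ ≤ 1 / 20 := le_trans (mul_le_mul_of_nonneg_right ht hρ0) h1
      have h3 : ρ ^ 2 ≤ 1 / 1600 := by nlinarith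
      have h4 : n * ρ ^ 2 ≤ n * (1 / 1600) := mul_le_mul_of_nonneg_left h3 hn0.le
      simp only [Fintype.card_fin]
      nlinarith) ht
  simp only [Fintype.card_fin] at hE1
  -- Here `R log p = nρ²`, and `96 ≤ 10²`.
  have hsqrt : √(96 * Real.log p * R * n) ≤ n * (10 * ρ) := by
    rw [Real.sqrt_le_left (by positivity)]
    have : 96 * Real.log p * R * n = 96 * n * (n * ρ ^ 2) := by rw [hρ]; ring
    rw [this]
    have : 0 ≤ n ^ 2 * ρ ^ 2 := by positivity
    nlinarith
  -- the noise
  obtain ⟨hi2, hb2⟩ := noise_sq_integrable_and_le hv hR0 hR hY2 hind fun i => (hmom i).1.2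
  have hE2 := measure_mul_lt_le (fun ω => dotProduct_self_nonneg (noise μ v Y ω)) hi2 hb2
    (s := t ^ 2) (by positivity)
  simp only [Fintype.card_fin] at hE2
  -- the squared responses
  have hsq2 : ∀ i, MemLp (fun ω => Y i ω ^ 2) 2 μ := fun i => by
    refine (memLp_two_iff_integrable_sq ((hY i).pow_const 2).aestronglyMeasurable).2 ?_
    refine (hmom i).2.1.congr (Eventually.of_forall fun ω => ?_)
    simp only
    ring
  have hb3 : ∫ ω, (∑ i, Y i ω ^ 2 - ∑ i, ∫ ω', Y i ω' ^ 2 ∂μ) ^ 2 ∂μ ≤ n * (2 * (K : ℝ) ^ 4) := by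
    refine (integral_sq_sum_sub_le hsq2
      (hind.comp (fun _ z => z.2 ^ 2) fun _ => by fun_prop)).trans ?_
    calc ∑ i, ∫ ω, (Y i ω ^ 2) ^ 2 ∂μ ≤ ∑ i : Fin n, 2 * (K : ℝ) ^ 4 := by
          refine Finset.sum_le_sum fun i _ => ?_
          refine le_trans (le_of_eq ?_) (hmom i).2.2
          exact integral_congr_ae (Eventually.of_forall fun ω => by ring)
      _ = _ := by simp
  have hE3 := measure_mul_lt_le (fun ω => sq_nonneg _) (integrable_sq_sum_sub hsq2 _) hb3
    (s := t ^ 2) (by positivity)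
  have hsum : ENNReal.ofReal (3 / t ^ 2) + ENNReal.ofReal (1 / t ^ 2) + ENNReal.ofReal (1 / t ^ 2)
      = ENNReal.ofReal (5 / t ^ 2) := by
    rw [← ENNReal.ofReal_add (by positivity) (by positivity),
      ← ENNReal.ofReal_add (by positivity) (by positivity)]
    congr 1
    ring
  rw [← hsum]
  refine le_trans (measure_mono ?_) ((measure_union_le _ _).trans
    (add_le_add ((measure_union_le _ _).trans (add_le_add hE1 hE2)) hE3))
  intro ω hω
  by_contra hcon
  simp only [Set.mem_union, Set.mem_ofPred_eq, not_or, not_not, not_lt] at hcon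
  obtain ⟨⟨h1, h2⟩, h3⟩ := hcon
  refine hω ⟨fun x y => (h1 x y).trans ?_, ?_, ?_⟩
  · refine mul_le_mul_of_nonneg_right ?_ (by positivity)
    calc t * √(96 * Real.log p * R * n) ≤ t * (n * (10 * ρ)) :=
          mul_le_mul_of_nonneg_left hsqrt ht0.le
      _ = _ := by ring
  · rw [Real.sqrt_le_left (by positivity)]
    refine h2.trans ?_
    have : t ^ 2 * (n * (R * K ^ 2)) ≤ t ^ 2 * (n * ((2 * (n * ρ ^ 2)) * K ^ 2)) := by gcongr
    refine this.trans ?_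
    have : 0 ≤ t ^ 2 * n ^ 2 * ρ ^ 2 * K ^ 2 := by positivity
    nlinarith
  · refine abs_le_of_sq_le_sq ?_ (by positivity)
    refine h3.trans ?_
    -- The variance bound `2nK⁴` carries no factor `R log p`; one is inserted using `1 ≤ R log p =
    -- nρ²`.
    have h5 : n * 1 ≤ n * (n * ρ ^ 2) := mul_le_mul_of_nonneg_left (by rw [hρ]; exact hRlog) hn0.le
    have h6 : 0 ≤ 2 * t ^ 2 * (K : ℝ) ^ 4 := by positivity
    have h7 := mul_le_mul_of_nonneg_left h5 h6
    have : 0 ≤ t ^ 2 * n ^ 2 * ρ ^ 2 * (K : ℝ) ^ 4 := by positivity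
    nlinarith

/-- Least squares over all submodels at a fixed sample size. -/
theorem measure_leastSquares_deviation_le {X : Fin n → Ω → 𝒳} {Y : Fin n → Ω → ℝ}
    {ψ : Fin p → 𝒳 → ℝ} (hX : ∀ i, Measurable (X i)) (hY : ∀ i, Measurable (Y i))
    (hψ : ∀ j, Measurable (ψ j)) (hind : iIndepFun (fun i ω => (X i ω, Y i ω)) μ) {K : ℝ≥0}
    (hK : UniformlySubGaussian μ Y K) {KX : ℝ} (hKX : ∀ i j, ∀ᵐ ω ∂μ, |ψ j (X i ω)| ≤ KX)
    (hΛ : 0 < lambdaMin μ X ψ) {fhat : Finset (Fin p) → Ω → 𝒳 → ℝ}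
    (hfhat : ∀ S ω, IsLeastSquares X Y (modelClass ψ S) ω (fhat S ω))
    {fstar : Finset (Fin p) → 𝒳 → ℝ} (hfstar : ∀ S, IsProjection μ X Y (modelClass ψ S) (fstar S))
    (hn : 1 ≤ n) (hp : 2 ≤ p) {ρ t : ℝ} (hρ0 : 0 ≤ ρ)
    (hρ : n * ρ ^ 2 = p * KX ^ 2 / lambdaMin μ X ψ ^ 2 * Real.log p)
    (ht : 2 ≤ t) (htρ : 20 * t * ρ ≤ 1) :
    μ {ω | ¬ ∀ S, theoNorm μ (fun i ω' => fhat S ω (X i ω') - fstar S (X i ω')) ≤ 24 * t * K * ρ ∧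
        |empNorm (fun i ω' => Y i ω' - fhat S ω (X i ω')) ω ^ 2
          - theoNorm μ (fun i ω' => Y i ω' - fstar S (X i ω')) ^ 2| ≤ 31 * t * K ^ 2 * ρ}
      ≤ ENNReal.ofReal (5 / t ^ 2) := by
  have hn0 : (0 : ℝ) < n := by exact_mod_cast hn
  have hK0 := K.coe_nonneg
  have ht0 : 0 < t := by linarith
  obtain ⟨B, φ, hφ, hlin, hR, hC⟩ := exists_whitening hX hψ hKX hn hΛ
  set R := p * KX ^ 2 / lambdaMin μ X ψ ^ 2
  set v : Fin n → Ω → Fin p → ℝ := fun i ω => φ (X i ω) with hvdef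
  have hv : ∀ i, Measurable (v i) := fun i => hφ.comp (hX i)
  have hind' : iIndepFun (fun i ω => (v i ω, Y i ω)) μ :=
    hind.comp (fun _ z => (φ z.1, z.2)) fun _ => (hφ.comp measurable_fst).prodMk measurable_snd
  have hmom := fun i => moments_le_of_psiTwoNorm_le (hY i) (hK i)
  have hY2 : ∀ i, MemLp (Y i) 2 μ := fun i =>
    (memLp_two_iff_integrable_sq (hY i).aestronglyMeasurable).2 (hmom i).1.1
  refine (measure_mono ?_).trans
    (measure_fluctuations_le hv hR hC hY hind' hK hn hp hρ0 hρ ht htρ)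
  intro ω hω hgood
  obtain ⟨g1, g2, g3⟩ := hgood
  refine hω fun S => ?_
  -- coordinates
  have hcoord : ∀ f ∈ modelClass ψ S, ∃ x : Fin p → ℝ, ∀ z, f z = x ⬝ᵥ φ z := by
    rintro f ⟨β, rfl⟩
    exact ⟨_, hlin _⟩
  have hmeas : ∀ x : Fin p → ℝ, Measurable fun z => x ⬝ᵥ φ z := fun x =>
    (by fun_prop : Continuous fun u : Fin p → ℝ => x ⬝ᵥ u).measurable.comp hφ
  obtain ⟨a, ha⟩ := hcoord _ (hfhat S ω).1
  obtain ⟨b, hb⟩ := hcoord _ (hfstar S).1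
  have hdiff : (fun z => fhat S ω z + (-1) * fstar S z) ∈ modelClass ψ S :=
    add_mul_mem_modelClass (hfhat S ω).1 (hfstar S).1 (-1)
  have hdz : ∀ z, fhat S ω z + (-1) * fstar S z = (a - b) ⬝ᵥ φ z := fun z => by
    rw [ha, hb, sub_dotProduct]; ring
  have hL : ∀ (x : Fin p → ℝ) i, MemLp (fun ω => x ⬝ᵥ v i ω) 2 μ := fun x i =>
    memLp_dotProduct (hv i) (hR i) x
  have hiYv : ∀ (x : Fin p → ℝ) i, Integrable (fun ω => Y i ω * (x ⬝ᵥ v i ω)) μ := fun x i =>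
    (hY2 i).integrable_mul (hL x i)
  set m : Fin p → ℝ := fun j => ∑ i, ∫ ω', Y i ω' * v i ω' j ∂μ with hm
  have hxm : ∀ x : Fin p → ℝ, x ⬝ᵥ m = ∑ i, ∫ ω, Y i ω * (x ⬝ᵥ v i ω) ∂μ := by
    intro x
    simp only [dotProduct, hm, Finset.mul_sum]
    rw [Finset.sum_comm]
    refine Finset.sum_congr rfl fun i _ => ?_
    have hij : ∀ j, Integrable (fun ω => Y i ω * (x j * v i ω j)) μ := fun j => by
      have := ((memLp_mul_coord (hv i) (hR i) (hY2 i) j).integrable (by norm_num)).const_mul (x j)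
      exact this.congr (Eventually.of_forall fun ω => by simp only; ring)
    rw [integral_finsetSum _ fun j _ => hij j]
    refine Finset.sum_congr rfl fun j _ => ?_
    rw [← integral_const_mul]
    exact integral_congr_ae (Eventually.of_forall fun ω => by simp only; ring)
  have hpop : ∀ (g : 𝒳 → ℝ) (x : Fin p → ℝ), g ∈ modelClass ψ S → (∀ z, g z = x ⬝ᵥ φ z) →
      x ⬝ᵥ m = n * (x ⬝ᵥ b) := by
    intro g x hg hgx
    have hgf : g = fun z => x ⬝ᵥ φ z := funext hgx
    have hff : fstar S = fun z => b ⬝ᵥ φ z := funext hb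
    have h := IsProjection.normal_equation hX hY2 (hfstar S) (g := g)
      (by rw [hff]; exact hL b) hg (by rw [hgf]; exact hmeas x) (by rw [hgf]; exact hL x)
    simp only [hgx, hb] at h
    rw [hxm, h, ← sum_integral_dotProduct_mul_dotProduct hv hR hC]
    exact Finset.sum_congr rfl fun i _ =>
      integral_congr_ae (Eventually.of_forall fun ω => mul_comm _ _)
  have hbm : b ⬝ᵥ m = n * (b ⬝ᵥ b) := hpop _ b (hfstar S).1 hb
  have hgm : (a - b) ⬝ᵥ m = n * ((a - b) ⬝ᵥ b) := hpop _ (a - b) hdiff hdz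
  have hemp : ∑ i, (Y i ω - a ⬝ᵥ v i ω) * ((a - b) ⬝ᵥ v i ω) = 0 := by
    have h := (hfhat S ω).normal_equation hdiff
    simp only [hdz] at h
    simp only [ha] at h
    exact h
  -- size of the population coefficients
  have hbb2 := sum_integral_dotProduct_mul_dotProduct hv hR hC b b
  set m₂ := ∑ i, ∫ ω', Y i ω' ^ 2 ∂μ with hm₂
  have hres : ∑ i, ∫ ω, (Y i ω - b ⬝ᵥ v i ω) ^ 2 ∂μ = m₂ - n * (b ⬝ᵥ b) := by
    have e : ∀ i, ∫ ω, (Y i ω - b ⬝ᵥ v i ω) ^ 2 ∂μ = ∫ ω, Y i ω ^ 2 ∂μ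
        - 2 * ∫ ω, Y i ω * (b ⬝ᵥ v i ω) ∂μ + ∫ ω, (b ⬝ᵥ v i ω) * (b ⬝ᵥ v i ω) ∂μ := by
      intro i
      have i1 := (hY2 i).integrable_sq
      have i2 := (hiYv b i).const_mul 2
      have i3 : Integrable (fun ω => (b ⬝ᵥ v i ω) * (b ⬝ᵥ v i ω)) μ :=
        (hL b i).integrable_mul (hL b i)
      have i4 : Integrable (fun ω => Y i ω ^ 2 - 2 * (Y i ω * (b ⬝ᵥ v i ω))) μ := i1.sub i2
      rw [← integral_const_mul, ← integral_sub i1 i2, ← integral_add i4 i3]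
      exact integral_congr_ae (Eventually.of_forall fun ω => by simp only; ring)
    simp only [e]
    rw [Finset.sum_add_distrib, Finset.sum_sub_distrib, ← Finset.mul_sum, hbb2, ← hxm, hbm]
    ring
  have hm₂le : m₂ ≤ n * (K : ℝ) ^ 2 := by
    refine (Finset.sum_le_sum fun i _ => (hmom i).1.2).trans (le_of_eq ?_)
    simp
  -- The projection is no longer than the response: the population residual `m₂ - n|b|²` is
  -- nonnegative and `m₂ ≤ nK²`.
  have hbK : √(b ⬝ᵥ b) ≤ K := by
    rw [Real.sqrt_le_left hK0]
    have h0 : 0 ≤ m₂ - n * (b ⬝ᵥ b) := by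
      rw [← hres]
      exact Finset.sum_nonneg fun i _ => integral_nonneg fun ω => sq_nonneg _
    exact le_of_mul_le_mul_left (by linarith) hn0
  obtain ⟨c1, c2⟩ := leastSquares_comparison (ξ := noise μ v Y ω) (m := m) hn0
    (by linarith : 10 * t * ρ ≤ 1 / 2) g1 (fun j => rfl) g2 hemp hgm hbm
  have htheo : theoNorm μ (fun i ω' => fhat S ω (X i ω') - fstar S (X i ω'))
      = √((a - b) ⬝ᵥ (a - b)) := by
    have : ∑ i, ∫ ω', (fhat S ω (X i ω') - fstar S (X i ω')) ^ 2 ∂μ = n * ((a - b) ⬝ᵥ (a - b)) := by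
      rw [← sum_integral_dotProduct_mul_dotProduct hv hR hC]
      refine Finset.sum_congr rfl fun i _ => integral_congr_ae (Eventually.of_forall fun ω' => ?_)
      simp only [ha, hb, hvdef, sub_dotProduct]
      ring
    rw [theoNorm, this, mul_div_cancel_left₀ _ hn0.ne']
  have hs : 0 ≤ 2 * t * K * ρ := by positivity
  have hτ0 : 0 ≤ 10 * t * ρ := by positivity
  have hB0 := Real.sqrt_nonneg (b ⬝ᵥ b)
  have hτB : 10 * t * ρ * √(b ⬝ᵥ b) ≤ 10 * t * ρ * K := mul_le_mul_of_nonneg_left hbK hτ0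
  -- The constant is `2(2 + 10)`, from the noise and the Gram matrix.
  have c1' : √((a - b) ⬝ᵥ (a - b)) ≤ 24 * t * K * ρ := by linarith
  refine ⟨by rw [htheo]; exact c1', ?_⟩
  have hempsq : empNorm (fun i ω' => Y i ω' - fhat S ω (X i ω')) ω ^ 2
      = (∑ i, (Y i ω - a ⬝ᵥ v i ω) ^ 2) / n := by
    rw [empNorm, Real.sq_sqrt (by positivity)]
    simp only [ha, hvdef]
  have htheosq : theoNorm μ (fun i ω' => Y i ω' - fstar S (X i ω')) ^ 2
      = (m₂ - n * (b ⬝ᵥ b)) / n := by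
    rw [← hres, theoNorm, Real.sq_sqrt]
    · simp only [hb, hvdef]
    · exact div_nonneg (Finset.sum_nonneg fun i _ => integral_nonneg fun ω => sq_nonneg _) hn0.le
  rw [hempsq, htheosq, ← sub_div, abs_div, abs_of_pos hn0, div_le_iff₀ hn0]
  refine (c2 m₂).trans ?_
  have d1 : 2 * (2 * t * K * ρ) * √(b ⬝ᵥ b) ≤ 2 * (2 * t * K * ρ) * K :=
    mul_le_mul_of_nonneg_left hbK (by positivity)
  have d2 : 10 * t * ρ * √(b ⬝ᵥ b) ^ 2 ≤ 10 * t * ρ * K ^ 2 :=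
    mul_le_mul_of_nonneg_left (pow_le_pow_left₀ hB0 hbK 2) hτ0
  have d3 : (2 * t * K * ρ + 10 * t * ρ * √(b ⬝ᵥ b)) * √((a - b) ⬝ᵥ (a - b))
      ≤ (12 * t * K * ρ) * (24 * t * K * ρ) :=
    mul_le_mul (by linarith) c1' (Real.sqrt_nonneg _) (by positivity)
  -- One factor `tρ ≤ 1/20` makes the quadratic term linear: `288/20 ≤ 15`. The total is then `2 + 4
  -- + 10 + 15 = 31`.
  have d4 : (12 * t * K * ρ) * (24 * t * K * ρ) ≤ 15 * t * (K : ℝ) ^ 2 * ρ := by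
    have h1 : 0 ≤ t * (K : ℝ) ^ 2 * ρ := by positivity
    have h2 := mul_le_mul_of_nonneg_left htρ h1
    nlinarith
  have d5 : 2 * (2 * t * K * ρ) * √(b ⬝ᵥ b) + 10 * t * ρ * √(b ⬝ᵥ b) ^ 2
      + (2 * t * K * ρ + 10 * t * ρ * √(b ⬝ᵥ b)) * √((a - b) ⬝ᵥ (a - b))
      ≤ 29 * t * (K : ℝ) ^ 2 * ρ := by nlinarith
  have d6 := mul_le_mul_of_nonneg_left d5 hn0.le
  linarith

end FixedSample

/-! ### From fixed samples to stochastic order -/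

theorem theoNorm_nonneg {Ω : Type*} [MeasurableSpace Ω] {n : ℕ} (μ : Measure Ω)
    (Z : Fin n → Ω → ℝ) : 0 ≤ theoNorm μ Z :=
  Real.sqrt_nonneg _

/-- The rate is `√(1 + K₀²) ρ`, where `ρ` is free of `K₀`. The bound `ρ ≤ δ` makes the smallness
condition eventually true, and `K₀ρ ≤ δ` is what the error bounds use. -/
theorem exists_base_rate {n p : ℕ} (hn : 1 ≤ n) (KX K₀ Λ : ℝ) :
    ∃ ρ : ℝ, 0 ≤ ρ ∧ n * ρ ^ 2 = p * KX ^ 2 / Λ ^ 2 * Real.log p ∧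
      ρ ≤ rate n p KX K₀ Λ ∧ K₀ * ρ ≤ rate n p KX K₀ Λ := by
  have hn0 : (0 : ℝ) < n := by exact_mod_cast hn
  set q : ℝ := p * KX ^ 2 / Λ ^ 2 * Real.log p / n with hq
  have hq0 : 0 ≤ q := by
    have := Real.log_natCast_nonneg p
    positivity
  have hrate : rate n p KX K₀ Λ = √((1 + K₀ ^ 2) * q) := by
    rw [rate]
    congr 1
    rw [hq, div_mul_eq_mul_div, div_div, mul_comm (n : ℝ) (Λ ^ 2), ← mul_div_assoc]
    congr 1
    ring
  refine ⟨√q, Real.sqrt_nonneg _, ?_, ?_, ?_⟩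
  · rw [Real.sq_sqrt hq0, hq, mul_div_cancel₀ _ hn0.ne']
  · rw [hrate]
    refine Real.sqrt_le_sqrt ?_
    nlinarith [mul_nonneg (sq_nonneg K₀) hq0]
  · rw [hrate]
    refine Real.le_sqrt_of_sq_le ?_
    rw [mul_pow, Real.sq_sqrt hq0]
    linarith

end LSWrongModel

end

theorem mainTheorem6
    {Ω 𝒳 : ℕ → Type*} [∀ n, MeasurableSpace (Ω n)] [∀ n, MeasurableSpace (𝒳 n)]
    (μ : ∀ n, Measure (Ω n)) [∀ n, IsProbabilityMeasure (μ n)]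
    (p : ℕ → ℕ) (hp : ∀ n, 2 ≤ p n)
    -- the observations and the dictionary at sample size `n`
    (X : ∀ n, Fin n → Ω n → 𝒳 n) (Y : ∀ n, Fin n → Ω n → ℝ) (ψ : ∀ n, Fin (p n) → 𝒳 n → ℝ)
    (hX : ∀ n i, Measurable (X n i)) (hY : ∀ n i, Measurable (Y n i))
    (hψ : ∀ n j, Measurable (ψ n j))
    (hindep : ∀ n, iIndepFun (fun i ω => (X n i ω, Y n i ω)) (μ n))
    (K₀ : ℕ → ℝ≥0) (hK₀ : ∀ n, LSWrongModel.UniformlySubGaussian (μ n) (Y n) (K₀ n))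
    (KX : ℕ → ℝ) (hKX : ∀ n i j, ∀ᵐ ω ∂(μ n), |ψ n j (X n i ω)| ≤ KX n)
    (hΛ : ∀ n, 1 ≤ n → 0 < LSWrongModel.lambdaMin (μ n) (X n) (ψ n))
    (δ : ℕ → ℝ)
    (hδ : ∀ n, δ n = LSWrongModel.rate n (p n) (KX n) (K₀ n)
      (LSWrongModel.lambdaMin (μ n) (X n) (ψ n)))
    (hδ0 : Tendsto δ atTop (𝓝 0))
    -- the least squares estimators and the projections, for every `S`
    (fhat : ∀ n, Finset (Fin (p n)) → Ω n → 𝒳 n → ℝ)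
    (hfhat : ∀ n S ω, LSWrongModel.IsLeastSquares (X n) (Y n)
      (LSWrongModel.modelClass (ψ n) S) ω (fhat n S ω))
    (fstar : ∀ n, Finset (Fin (p n)) → 𝒳 n → ℝ)
    (hfstar : ∀ n S, LSWrongModel.IsProjection (μ n) (X n) (Y n)
      (LSWrongModel.modelClass (ψ n) S) (fstar n S)) :
    LSWrongModel.IsBigOInProb μ
      (fun n ω => ⨆ S : Finset (Fin (p n)),
        LSWrongModel.theoNorm (μ n)
          (fun i ω' => fhat n S ω (X n i ω') - fstar n S (X n i ω'))) δ
    ∧ (BddAbove (Set.range K₀) →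
      LSWrongModel.IsBigOInProb μ
        (fun n ω => ⨆ S : Finset (Fin (p n)),
          |LSWrongModel.empNorm (fun i ω' => Y n i ω' - fhat n S ω (X n i ω')) ω ^ 2
            - LSWrongModel.theoNorm (μ n)
                (fun i ω' => Y n i ω' - fstar n S (X n i ω')) ^ 2|) δ) := by

  have key : ∀ ε : ℝ, 0 < ε → ∃ t : ℝ, 2 ≤ t ∧ ∀ᶠ n in atTop, ∃ ρ : ℝ, 0 ≤ ρ ∧
      K₀ n * ρ ≤ δ n ∧
      μ n {ω | ¬ ∀ S, LSWrongModel.theoNorm (μ n)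
            (fun i ω' => fhat n S ω (X n i ω') - fstar n S (X n i ω')) ≤ 24 * t * K₀ n * ρ ∧
          |LSWrongModel.empNorm (fun i ω' => Y n i ω' - fhat n S ω (X n i ω')) ω ^ 2
            - LSWrongModel.theoNorm (μ n) (fun i ω' => Y n i ω' - fstar n S (X n i ω')) ^ 2|
            ≤ 31 * t * K₀ n ^ 2 * ρ} ≤ ENNReal.ofReal ε := by
    intro ε hε
    -- The summand `5 / ε` makes `5 / t² ≤ ε`, and the summand 2 meets the lower bound on `t`.
    have ht2 : 2 ≤ 2 + 5 / ε := by
      have : 0 < 5 / ε := by positivity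
      linarith
    refine ⟨2 + 5 / ε, ht2, ?_⟩
    set t := 2 + 5 / ε with ht
    have ht0 : 0 < t := by linarith
    have hδs : ∀ᶠ n in atTop, δ n < 1 / (20 * t) :=
      hδ0.eventually (gt_mem_nhds (by positivity))
    filter_upwards [hδs, eventually_ge_atTop 1] with n hn hn1
    obtain ⟨ρ, hρ0, hρ, hρδ, hKρ⟩ := LSWrongModel.exists_base_rate (p := p n) hn1 (KX n) (K₀ n)
      (LSWrongModel.lambdaMin (μ n) (X n) (ψ n))
    rw [← hδ n] at hρδ hKρ
    have htρ : 20 * t * ρ ≤ 1 := by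
      have h1 := (hρδ.trans_lt hn).le
      rw [le_div_iff₀ (by positivity)] at h1
      linarith
    refine ⟨ρ, hρ0, hKρ, ?_⟩
    refine (LSWrongModel.measure_leastSquares_deviation_le (hX n) (hY n) (hψ n) (hindep n) (hK₀ n)
      (hKX n) (hΛ n hn1) (hfhat n) (hfstar n) hn1 (hp n) hρ0 hρ ht2 htρ).trans ?_
    refine ENNReal.ofReal_le_ofReal ?_
    rw [div_le_iff₀ (by positivity)]
    have h2 : 5 / ε ≤ t ^ 2 := by nlinarith
    calc (5 : ℝ) = ε * (5 / ε) := by field_simp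
      _ ≤ ε * t ^ 2 := mul_le_mul_of_nonneg_left h2 hε.le
  constructor
  · intro ε hε
    obtain ⟨t, ht, hev⟩ := key ε hε
    refine ⟨24 * t, ?_⟩
    filter_upwards [hev] with n hn
    obtain ⟨ρ, hρ0, hKρ, hμ⟩ := hn
    refine (measure_mono ?_).trans hμ
    intro ω hω hall
    rw [Set.mem_ofPred_eq] at hω
    refine absurd hω (not_lt.2 ?_)
    rw [abs_of_nonneg (Real.iSup_nonneg fun S => LSWrongModel.theoNorm_nonneg _ _)]
    refine ciSup_le fun S => (hall S).1.trans ?_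
    have := mul_le_mul_of_nonneg_left hKρ (by linarith : 0 ≤ 24 * t)
    linarith
  · rintro ⟨B, hB⟩ ε hε
    obtain ⟨t, ht, hev⟩ := key ε hε
    refine ⟨31 * t * B, ?_⟩
    filter_upwards [hev] with n hn
    obtain ⟨ρ, hρ0, hKρ, hμ⟩ := hn
    refine (measure_mono ?_).trans hμ
    intro ω hω hall
    rw [Set.mem_ofPred_eq] at hω
    refine absurd hω (not_lt.2 ?_)
    rw [abs_of_nonneg (Real.iSup_nonneg fun S => abs_nonneg _)]
    refine ciSup_le fun S => (hall S).2.trans ?_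
    -- The risk bound is of order `K₀²ρ`, while `δ` absorbs only one factor `K₀`; the other is
    -- bounded by `B`.
    have hKB : (K₀ n : ℝ) ≤ B := by exact_mod_cast hB ⟨n, rfl⟩
    have h1 : (K₀ n : ℝ) * (K₀ n * ρ) ≤ B * δ n :=
      mul_le_mul hKB hKρ (by positivity) B.coe_nonneg
    have := mul_le_mul_of_nonneg_left h1 (by linarith : 0 ≤ 31 * t)
    linarith
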